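/- Let $E$ be a Dedekind complete vector lattice over $\mathbb R$. Let $\mathcal L_{\mathrm{ob}}(E)$ be the vector lattice and algebra of order bounded linear operators on $E$ (ordered by $S\le T$ iff $Sx\le Tx$ for all $x\ge 0$), and let $\mathrm{Orth}(E)\subseteq\mathcal L_{\mathrm{ob}}(E)$ be the orthomorphisms, i.e. the order bounded linear operators that map every band of $E$ into itself. A net $(x_\alpha)$ in a vector lattice $X$ is order convergent to $x$ if there is a net $y_\beta\downarrow 0$ in $X$, possibly over a different index set, such that for every $\beta_0$ there is an $\alpha_0$ with $|x-x_\alpha|\le y_{\beta_0}$ for all $\alpha\ge\alpha_0$; it is uo-convergent to $x$ if $|x_\alpha-x|\wedge y$ is order convergent to $0$ for every $y\in X^+$. A net $(T_\alpha)$ in $\mathcal L_{\mathrm{ob}}(E)$ is SUO-convergent to $T\in\mathcal L_{\mathrm{ob}}(E)$ if $T_\alpha x$ is uo-convergent to $Tx$ in $E$ for every $x\in E$. The uo-adherence (resp. SUO-adherence) in $\mathcal L_{\mathrm{ob}}(E)$ of a subset is the set of all limits in $\mathcal L_{\mathrm{ob}}(E)$ of uo-convergent (resp. SUO-convergent) nets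 in that subset. Subalgebras are not required to contain the identity operator. (1) Let $(S_\alpha)_{\alpha\in A}$ and $(T_\beta)_{\beta\in B}$ be nets in $\mathrm{Orth}(E)$ such that $S_\alpha\to S$ and $T_\beta\to T$ in the sense of uo-convergence in $\mathcal L_{\mathrm{ob}}(E)$, where $S,T\in\mathcal L_{\mathrm{ob}}(E)$. Then $S,T\in\mathrm{Orth}(E)$, and the net $(S_\alpha T_\beta)_{(\alpha,\beta)\in A\times B}$ is uo-convergent to $ST$ in $\mathcal L_{\mathrm{ob}}(E)$. The seven similar statements also hold that are obtained by, for each of the three occurrences of uo-convergence, independently either keeping it or replacing it with SUO-convergence. (2) Let $\mathcal A$ be a subalgebra of $\mathrm{Orth}(E)$. Then the uo-adherence and the SUO-adherence of $\mathcal A$ in $\mathcal L_{\mathrm{ob}}(E)$ are equal, and they are a subalgebra of $\mathrm{Orth}(E)$. When $\mathcal A$ is moreover a vector sublattice of $\mathrm{Orth}(E)$, then so is this adherence. -/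

import Mathlib

open Set

universe u v

namespace OrthoUO

section Convergence

/-- Order convergence of a net `x` to `l` in a vector lattice `X`: there is a net `y ↓ 0`, over a
possibly different index set `B`, such that every `y b` eventually dominates `|l - x a|`.
Only the set of values of `y` matters, so it is no restriction to take `B` in the universe
of `X`. -/
def OrderConverges {X : Type u} [Lattice X] [AddCommGroup X] {A : Type v} [Preorder A]
    (x : A → X) (l : X) : Prop :=
  ∃ (B : Type u) (_ : Preorder B) (_ : IsDirectedOrder B) (_ : Nonempty B) (y : B → X),
    Antitone y ∧ IsGLB (range y) 0 ∧ ∀ b₀ : B, ∃ a₀ : A, ∀ a : A, a₀ ≤ a → |l - x a| ≤ y b₀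

/-- Unbounded order convergence of a net `x` to `l` in a vector lattice `X`. -/
def UOConverges {X : Type u} [Lattice X] [AddCommGroup X] {A : Type v} [Preorder A]
    (x : A → X) (l : X) : Prop :=
  ∀ y : X, 0 ≤ y → OrderConverges (fun a => |x a - l| ⊓ y) 0

end Convergence

section Operators

variable {E : Type u} [ConditionallyCompleteLattice E] [AddCommGroup E] [IsOrderedAddMonoid E]
  [Module ℝ E] [PosSMulMono ℝ E]

/-- A linear operator is order bounded when it maps order intervals to order bounded sets. -/
def IsOrderBounded (T : Module.End ℝ E) : Prop :=
  ∀ a b : E, BddAbove (T '' Icc a b) ∧ BddBelow (T '' Icc a b)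

set_option linter.unusedSectionVars false in
lemma isOrderBounded_iff (T : Module.End ℝ E) :
    IsOrderBounded T ↔ ∀ a b : E, ∃ c d : E, ∀ x, a ≤ x → x ≤ b → c ≤ T x ∧ T x ≤ d := by
  constructor
  · intro h a b
    obtain ⟨⟨d, hd⟩, ⟨c, hc⟩⟩ := h a b
    exact ⟨c, d, fun x h1 h2 => ⟨hc ⟨x, ⟨h1, h2⟩, rfl⟩, hd ⟨x, ⟨h1, h2⟩, rfl⟩⟩⟩
  · intro h a b
    obtain ⟨c, d, hcd⟩ := h a b
    refine ⟨⟨d, ?_⟩, ⟨c, ?_⟩⟩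
    · rintro _ ⟨x, ⟨h1, h2⟩, rfl⟩
      exact (hcd x h1 h2).2
    · rintro _ ⟨x, ⟨h1, h2⟩, rfl⟩
      exact (hcd x h1 h2).1

lemma isOrderBounded_of_monotone {T : Module.End ℝ E} (hT : Monotone T) : IsOrderBounded T :=
  (isOrderBounded_iff T).2 fun a b => ⟨T a, T b, fun _ h1 h2 => ⟨hT h1, hT h2⟩⟩

variable (E) in
/-- The order bounded operators, as a subalgebra of the algebra of all linear operators. -/
def orderBoundedSubalgebra : Subalgebra ℝ (Module.End ℝ E) where
  carrier := {T | IsOrderBounded T}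
  mul_mem' := by
    intro S T hS hT
    simp only [mem_ofPred_eq, isOrderBounded_iff] at hS hT ⊢
    intro a b
    obtain ⟨c, d, h⟩ := hT a b
    obtain ⟨c', d', h'⟩ := hS c d
    exact ⟨c', d', fun x h1 h2 => h' _ (h x h1 h2).1 (h x h1 h2).2⟩
  add_mem' := by
    intro S T hS hT
    simp only [mem_ofPred_eq, isOrderBounded_iff] at hS hT ⊢
    intro a b
    obtain ⟨c, d, h⟩ := hT a b
    obtain ⟨c', d', h'⟩ := hS a b
    exact ⟨c' + c, d' + d, fun x h1 h2 =>
      ⟨add_le_add (h' x h1 h2).1 (h x h1 h2).1, add_le_add (h' x h1 h2).2 (h x h1 h2).2⟩⟩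
  algebraMap_mem' := by
    intro r
    simp only [mem_ofPred_eq, isOrderBounded_iff]
    intro a b
    rcases le_total 0 r with hr | hr
    · refine ⟨r • a, r • b, fun x h1 h2 => ?_⟩
      simp only [Module.algebraMap_end_apply]
      exact ⟨smul_le_smul_of_nonneg_left h1 hr, smul_le_smul_of_nonneg_left h2 hr⟩
    · refine ⟨r • b, r • a, fun x h1 h2 => ?_⟩
      simp only [Module.algebraMap_end_apply]
      have hr' : 0 ≤ -r := by linarith
      have e1 := smul_le_smul_of_nonneg_left h1 hr'
      have e2 := smul_le_smul_of_nonneg_left h2 hr'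
      simp only [neg_smul, neg_le_neg_iff] at e1 e2
      exact ⟨e2, e1⟩

variable (E) in
/-- The space `L_b(E)` of order bounded linear operators on `E`. -/
def Lb : Type u := ↥(orderBoundedSubalgebra E)

noncomputable instance : Ring (Lb E) := inferInstanceAs (Ring ↥(orderBoundedSubalgebra E))

noncomputable instance : Algebra ℝ (Lb E) :=
  inferInstanceAs (Algebra ℝ ↥(orderBoundedSubalgebra E))

/-- The underlying linear operator of an element of `L_b(E)`. -/
def Lb.toEnd (T : Lb E) : Module.End ℝ E := T.1

instance : CoeFun (Lb E) (fun _ => E → E) := ⟨fun T => T.toEnd⟩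

lemma Lb.ext {S T : Lb E} (h : ∀ x, S x = T x) : S = T :=
  Subtype.ext (LinearMap.ext h)

@[simp] lemma Lb.add_apply (S T : Lb E) (x : E) : (S + T) x = S x + T x := rfl
@[simp] lemma Lb.sub_apply (S T : Lb E) (x : E) : (S - T) x = S x - T x := rfl
@[simp] lemma Lb.neg_apply (S : Lb E) (x : E) : (-S) x = -S x := rfl
@[simp] lemma Lb.zero_apply (x : E) : (0 : Lb E) x = 0 := rfl
@[simp] lemma Lb.one_apply (x : E) : (1 : Lb E) x = x := rfl
@[simp] lemma Lb.mul_apply (S T : Lb E) (x : E) : (S * T) x = S (T x) := rfl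
@[simp] lemma Lb.smul_apply (r : ℝ) (T : Lb E) (x : E) : (r • T) x = r • T x := rfl

/-- The usual order on operators: `S ≤ T` when `S x ≤ T x` for all `x ≥ 0`. -/
instance : PartialOrder (Lb E) where
  le S T := ∀ x : E, 0 ≤ x → S x ≤ T x
  le_refl _ _ _ := le_rfl
  le_trans _ _ _ h h' x hx := (h x hx).trans (h' x hx)
  le_antisymm S T h h' := by
    have key : ∀ x : E, 0 ≤ x → S x = T x := fun x hx => le_antisymm (h x hx) (h' x hx)
    refine Lb.ext fun x => ?_
    rw [← posPart_sub_negPart x, map_sub, map_sub, key _ (posPart_nonneg x),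
      key _ (negPart_nonneg x)]

lemma Lb.le_def {S T : Lb E} : S ≤ T ↔ ∀ x : E, 0 ≤ x → S x ≤ T x := Iff.rfl

instance : IsOrderedAddMonoid (Lb E) where
  add_le_add_left S T h U x hx := by
    simpa using h x hx

instance : PosSMulMono ℝ (Lb E) where
  smul_le_smul_of_nonneg_left r hr S T h x hx := by
    simpa using smul_le_smul_of_nonneg_left (h x hx) hr

/-! The lattice structure of `L_b(E)`. For `x ≥ 0`, the positive part of `T` at `x` is the supremum
of `T z` over `0 ≤ z ≤ x` (Riesz and Kantorovich). -/

/-- The supremum of `T z` over `0 ≤ z ≤ x`; used for `x ≥ 0` only. -/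
noncomputable def rk (T : Lb E) (x : E) : E := sSup (T '' Icc 0 x)

lemma le_rk (T : Lb E) {x z : E} (h0 : 0 ≤ z) (hz : z ≤ x) : T z ≤ rk T x :=
  le_csSup (T.2 0 x).1 ⟨z, ⟨h0, hz⟩, rfl⟩

lemma rk_le (T : Lb E) {x c : E} (hx : 0 ≤ x) (h : ∀ z, 0 ≤ z → z ≤ x → T z ≤ c) :
    rk T x ≤ c := by
  refine csSup_le ⟨_, ⟨0, ⟨le_rfl, hx⟩, rfl⟩⟩ ?_
  rintro _ ⟨z, ⟨h0, hz⟩, rfl⟩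
  exact h z h0 hz

lemma rk_nonneg (T : Lb E) {x : E} (hx : 0 ≤ x) : 0 ≤ rk T x := by
  simpa using le_rk T le_rfl hx

lemma rk_add (T : Lb E) {x y : E} (hx : 0 ≤ x) (hy : 0 ≤ y) :
    rk T (x + y) = rk T x + rk T y := by
  apply le_antisymm
  · refine rk_le T (add_nonneg hx hy) fun z h0 hz => ?_
    have e : z = z ⊓ x + (z - z ⊓ x) := by abel
    rw [e, map_add]
    refine add_le_add (le_rk T (le_inf h0 hx) inf_le_right)
      (le_rk T (sub_nonneg.2 inf_le_left) ?_)
    rw [sub_le_comm]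
    exact le_inf (sub_le_self z hy) (by rwa [sub_le_iff_le_add])
  · have h1 : ∀ z, 0 ≤ z → z ≤ y → rk T x ≤ rk T (x + y) - T z := by
      intro z h0 hz
      refine rk_le T hx fun w hw0 hw => ?_
      rw [le_sub_iff_add_le, ← map_add]
      exact le_rk T (add_nonneg hw0 h0) (add_le_add hw hz)
    have h2 : rk T y ≤ rk T (x + y) - rk T x :=
      rk_le T hy fun z h0 hz => by
        rw [le_sub_comm]
        exact h1 z h0 hz
    rw [add_comm]
    exact le_sub_iff_add_le.1 h2

lemma rk_smul_le (T : Lb E) {r : ℝ} (hr : 0 < r) {x : E} (hx : 0 ≤ x) :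
    rk T (r • x) ≤ r • rk T x := by
  refine rk_le T (smul_nonneg hr.le hx) fun z h0 hz => ?_
  have e : z = r • (r⁻¹ • z) := by rw [smul_smul, mul_inv_cancel₀ hr.ne', one_smul]
  rw [e, map_smul]
  refine smul_le_smul_of_nonneg_left (le_rk T (smul_nonneg (inv_nonneg.2 hr.le) h0) ?_) hr.le
  have := smul_le_smul_of_nonneg_left hz (inv_nonneg.2 hr.le)
  rwa [smul_smul, inv_mul_cancel₀ hr.ne', one_smul] at this

lemma rk_smul (T : Lb E) {r : ℝ} (hr : 0 ≤ r) {x : E} (hx : 0 ≤ x) :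
    rk T (r • x) = r • rk T x := by
  rcases hr.eq_or_lt with rfl | hr
  · rw [zero_smul, zero_smul]
    refine le_antisymm (rk_le T le_rfl fun z h0 hz => ?_) (rk_nonneg T le_rfl)
    rw [le_antisymm hz h0, map_zero]
  · refine le_antisymm (rk_smul_le T hr hx) ?_
    have h := rk_smul_le T (inv_pos.2 hr) (smul_nonneg hr.le hx)
    rw [smul_smul, inv_mul_cancel₀ hr.ne', one_smul] at h
    have := smul_le_smul_of_nonneg_left h hr.le
    rwa [smul_smul, mul_inv_cancel₀ hr.ne', one_smul] at this

lemma rk_sub_eq (T : Lb E) {a b c d : E} (ha : 0 ≤ a) (hb : 0 ≤ b) (hc : 0 ≤ c) (hd : 0 ≤ d)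
    (h : a - b = c - d) : rk T a - rk T b = rk T c - rk T d := by
  rw [sub_eq_sub_iff_add_eq_add] at h ⊢
  rw [← rk_add T ha hd, ← rk_add T hc hb, h]

/-- The positive part of `T`, as a linear operator. -/
noncomputable def posPartEnd (T : Lb E) : Module.End ℝ E where
  toFun x := rk T x⁺ - rk T x⁻
  map_add' x y := by
    have hx := posPart_nonneg x
    have hy := posPart_nonneg y
    have hx' := negPart_nonneg x
    have hy' := negPart_nonneg y
    rw [rk_sub_eq T (posPart_nonneg (x + y)) (negPart_nonneg (x + y)) (add_nonneg hx hy)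
      (add_nonneg hx' hy'), rk_add T hx hy, rk_add T hx' hy']
    · abel
    · rw [posPart_sub_negPart, add_sub_add_comm, posPart_sub_negPart, posPart_sub_negPart]
  map_smul' r x := by
    have hx := posPart_nonneg x
    have hx' := negPart_nonneg x
    simp only [RingHom.id_apply]
    rcases le_total 0 r with hr | hr
    · rw [rk_sub_eq T (posPart_nonneg (r • x)) (negPart_nonneg (r • x)) (smul_nonneg hr hx)
        (smul_nonneg hr hx'), rk_smul T hr hx, rk_smul T hr hx', smul_sub]
      rw [posPart_sub_negPart, ← smul_sub, posPart_sub_negPart]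
    · have hr' : 0 ≤ -r := by linarith
      rw [rk_sub_eq T (posPart_nonneg (r • x)) (negPart_nonneg (r • x)) (smul_nonneg hr' hx')
        (smul_nonneg hr' hx), rk_smul T hr' hx, rk_smul T hr' hx']
      · rw [neg_smul, neg_smul, smul_sub]
        abel
      · rw [posPart_sub_negPart, neg_smul, neg_smul, neg_sub_neg, ← smul_sub,
          posPart_sub_negPart]

lemma posPartEnd_apply (T : Lb E) {x : E} (hx : 0 ≤ x) : posPartEnd T x = rk T x := by
  have h : rk T x⁺ - rk T x⁻ = rk T x - rk T 0 :=
    rk_sub_eq T (posPart_nonneg x) (negPart_nonneg x) hx le_rfl (by simp [posPart_sub_negPart])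
  have h0 : rk T 0 = 0 := by simpa using rk_smul T (le_refl (0 : ℝ)) (le_refl (0 : E))
  rw [h0, sub_zero] at h
  exact h

lemma posPartEnd_monotone (T : Lb E) : Monotone (posPartEnd T) := by
  intro x y hxy
  rw [← sub_nonneg, ← map_sub, posPartEnd_apply T (sub_nonneg.2 hxy)]
  exact rk_nonneg T (sub_nonneg.2 hxy)

/-- The positive part of `T` in `L_b(E)`. -/
noncomputable def Lb.pos (T : Lb E) : Lb E :=
  ⟨posPartEnd T, isOrderBounded_of_monotone (posPartEnd_monotone T)⟩

lemma Lb.pos_apply (T : Lb E) {x : E} (hx : 0 ≤ x) : T.pos x = sSup (T '' Icc 0 x) :=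
  posPartEnd_apply T hx

lemma Lb.isLUB_pos (T : Lb E) : IsLUB {T, 0} T.pos := by
  constructor
  · rintro U (rfl | rfl) x hx
    · rw [Lb.pos_apply U hx]
      exact le_rk U hx le_rfl
    · rw [Lb.pos_apply T hx]
      exact rk_nonneg T hx
  · intro U hU x hx
    have h1 : T ≤ U := hU (by simp)
    have h0 : 0 ≤ U := hU (by simp)
    rw [Lb.pos_apply T hx]
    refine rk_le T hx fun z hz0 hz => (h1 z hz0).trans ?_
    rw [← sub_nonneg, ← map_sub]
    exact h0 _ (sub_nonneg.2 hz)

/-- `L_b(E)` is a vector lattice for the usual order on operators. -/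
noncomputable instance : Lattice (Lb E) where
  sup S T := T + (S - T).pos
  le_sup_left S T := sub_le_iff_le_add'.1 ((S - T).isLUB_pos.1 (by simp))
  le_sup_right S T := le_add_of_nonneg_right ((S - T).isLUB_pos.1 (by simp))
  sup_le S T U h h' := by
    rw [← le_sub_iff_add_le']
    refine (S - T).isLUB_pos.2 ?_
    rintro _ (rfl | rfl)
    · exact sub_le_sub_right h T
    · exact sub_nonneg.2 h'
  inf S T := S - (S - T).pos
  inf_le_left S T := sub_le_self S ((S - T).isLUB_pos.1 (by simp))
  inf_le_right S T := sub_le_comm.1 ((S - T).isLUB_pos.1 (by simp))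
  le_inf U S T h h' := by
    rw [le_sub_comm]
    refine (S - T).isLUB_pos.2 ?_
    rintro _ (rfl | rfl)
    · exact sub_le_sub_left h' S
    · exact sub_nonneg.2 h

/-- A band: a solid linear subspace that contains the suprema in `E` of its subsets. -/
structure IsBand (B : Submodule ℝ E) : Prop where
  solid : ∀ ⦃x y : E⦄, |x| ≤ |y| → y ∈ B → x ∈ B
  isLUB_mem : ∀ ⦃D : Set E⦄ ⦃s : E⦄, D ⊆ B → IsLUB D s → s ∈ B

variable (E) in
/-- The orthomorphisms: the order bounded operators that leave every band invariant. They form a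
subalgebra of `L_b(E)`. -/
def Orth : Subalgebra ℝ (Lb E) where
  carrier := {T | ∀ B : Submodule ℝ E, IsBand B → ∀ x ∈ B, T x ∈ B}
  mul_mem' hS hT B hB _ hx := hS B hB _ (hT B hB _ hx)
  add_mem' hS hT B hB _ hx := B.add_mem (hS B hB _ hx) (hT B hB _ hx)
  algebraMap_mem' r B _ _ hx := B.smul_mem r hx

/-- Strong unbounded order convergence in `L_b(E)`: pointwise unbounded order convergence. -/
def SUOConverges {A : Type v} [Preorder A] (T : A → Lb E) (L : Lb E) : Prop :=
  ∀ x : E, UOConverges (fun a => T a x) (L x)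

/-- The `uo`-adherence of `M` in `L_b(E)`: all `uo`-limits in `L_b(E)` of nets in `M`. The
convergence depends only on the filter of tails of the net, so it is no restriction to take the
index sets in the universe of `E`. -/
def uoAdherence (M : Set (Lb E)) : Set (Lb E) :=
  {L | ∃ (A : Type u) (_ : Preorder A) (_ : IsDirectedOrder A) (_ : Nonempty A) (T : A → Lb E),
    (∀ a, T a ∈ M) ∧ UOConverges T L}

/-- The `SUO`-adherence of `M` in `L_b(E)`: all `SUO`-limits in `L_b(E)` of nets in `M`. -/
def suoAdherence (M : Set (Lb E)) : Set (Lb E) :=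
  {L | ∃ (A : Type u) (_ : Preorder A) (_ : IsDirectedOrder A) (_ : Nonempty A) (T : A → Lb E),
    (∀ a, T a ∈ M) ∧ SUOConverges T L}

end Operators

/-- The two modes of convergence. -/
inductive Mode
  | uo
  | suo

/-- Convergence in `L_b(E)` of a net of operators in the given mode. -/
def Mode.Converges {E : Type u} [ConditionallyCompleteLattice E] [AddCommGroup E]
    [IsOrderedAddMonoid E] [Module ℝ E] [PosSMulMono ℝ E] {A : Type v} [Preorder A] :
    Mode → (A → Lb E) → Lb E → Prop
  | Mode.uo, T, L => UOConverges T L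
  | Mode.suo, T, L => SUOConverges T L

end OrthoUO

/-!
An orthomorphism acts like multiplication by a function, and unbounded order convergence behaves
like a local form of convergence. The proof makes both precise without representation theory and
without band projections, by shrinking positive vectors.

*Convergence.* In the Dedekind complete space `E`, a net `x` is `uo`-convergent to `l` exactly when
for every `z > 0` there is `0 < w ≤ z` such that eventually `|x a - l| ≤ z` on the part of `E`
seen by `w`, that is, `(|x a - l| - z)⁺` is disjoint from `w` (`LocallyNull`,
`uoConverges_iff_locallyNull`). In this form limits of sums and of dominated nets are immediate.

*Orthomorphisms.* An operator is an orthomorphism exactly when it preserves disjointness from each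
fixed vector (`mem_Orth_iff`), because every band is an intersection of disjoint complements. If
`0 ≤ z ≤ x`, then locally `z` differs from a multiple `(i / N) x` with `0 ≤ i / N ≤ 1` by at most
`x / N`, so order boundedness and the Archimedean property give `T z ≤ (T x)⁺`. By the
Riesz-Kantorovich formula, finite suprema and infima of orthomorphisms are pointwise on positive
vectors (`Orth.sup_apply`). Infima of downward directed sets of arbitrary operators are pointwise
too (`exists_isGLB_of_directed`), hence so are suprema of arbitrary order bounded sets of
orthomorphisms (`Orth.isLUB_apply_le`).

*The two modes agree.* Limits of orthomorphisms in either mode are orthomorphisms, and for nets of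
orthomorphisms the two modes of convergence coincide (`uoConverges_iff_suoConverges`). From `uo` to
`SUO` one truncates with a multiple of the identity; in the other direction the suprema of the
tails of `|T a - L| ⊓ Y` are evaluated pointwise.

*Products.* It remains to treat `SUO`-convergence. Write
`S a * T b - S * T = S a * (T b - T) + (S a - S) * T`. The second term is harmless. For the first,
the net `S a` is locally eventually bounded by a multiple of the identity
(`SUOConverges.exists_eventually_bounded`), since `S a z` converges. The statements on adherences
follow from the continuity of the algebraic and lattice operations along product nets.
-/

set_option linter.unusedSectionVars false

namespace OrthoUO

/-! ### Lattice ordered groups -/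

section LatticeGroup

variable {X : Type u} [Lattice X] [AddCommGroup X] [IsOrderedAddMonoid X]

/-- The infinite distributive law of a lattice ordered group, in the form in which it is used. -/
lemma inf_le_of_isLUB {D : Set X} {s z c : X} (h : IsLUB D s) (hc : ∀ t ∈ D, t ⊓ z ≤ c) :
    s ⊓ z ≤ c := by
  have h1 : s ≤ c + s ⊔ z - z := h.2 fun t ht => by
    rw [le_sub_iff_add_le, ← inf_add_sup t z]
    exact add_le_add (hc t ht) (sup_le_sup_right (h.1 ht) z)
  rw [le_sub_iff_add_le, ← inf_add_sup s z] at h1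
  exact le_of_add_le_add_right h1

lemma add_inf_le_inf_add_inf {a b c : X} (ha : 0 ≤ a) (hb : 0 ≤ b) (hc : 0 ≤ c) :
    (a + b) ⊓ c ≤ a ⊓ c + b ⊓ c := by
  rw [add_inf, inf_add, inf_add]
  refine le_inf (le_inf inf_le_left (inf_le_right.trans ?_))
    (le_inf (inf_le_right.trans ?_) (inf_le_right.trans ?_))
  · exact le_add_of_nonneg_right hb
  · exact le_add_of_nonneg_left ha
  · exact le_add_of_nonneg_left hc

lemma posPart_add_le (a b : X) : (a + b)⁺ ≤ a⁺ + b⁺ :=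
  sup_le (add_le_add (le_posPart a) (le_posPart b))
    (add_nonneg (posPart_nonneg a) (posPart_nonneg b))

/-- Truncating `u` at `2z` does not change the excess over `z` below `z`. -/
lemma posPart_inf_sub (u z w : X) (hw : w ≤ z) : (u - z)⁺ ⊓ w ≤ (u ⊓ (z + z) - z)⁺ := by
  have e : u ⊓ (z + z) - z = (u - z) ⊓ z := by
    rw [inf_sub, add_sub_cancel_right]
  rw [e]
  refine (inf_le_inf_left _ hw).trans ?_
  rw [posPart_def, posPart_def]
  let _ := AddCommGroup.toDistribLattice X
  rw [inf_sup_right]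
  exact sup_le_sup_left inf_le_left _

lemma abs_sub_le_abs_add (a b : X) : |a - b| ≤ |a| + |b| := by
  simpa [sub_eq_add_neg] using abs_add_le a (-b)

lemma abs_sup_sub_sup_le (a b c d : X) : |a ⊔ b - c ⊔ d| ≤ |a - c| + |b - d| := by
  have key : ∀ a b c d : X, a ⊔ b - c ⊔ d ≤ |a - c| + |b - d| := by
    intro a b c d
    rw [sub_le_iff_le_add]
    refine sup_le ?_ ?_
    · refine le_trans ?_ (add_le_add (le_add_of_nonneg_right (abs_nonneg _)) le_sup_left)
      exact sub_le_iff_le_add.1 (le_abs_self _)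
    · refine le_trans ?_ (add_le_add (le_add_of_nonneg_left (abs_nonneg _)) le_sup_right)
      exact sub_le_iff_le_add.1 (le_abs_self _)
  refine abs_le'.2 ⟨key a b c d, ?_⟩
  rw [neg_sub, abs_sub_comm a, abs_sub_comm b]
  exact key c d a b

/-- Unbounded order convergence in terms of the set of all eventual upper bounds: the net that is
required to decrease to zero can be taken to be this set. -/
lemma uoConverges_iff_isGLB {A : Type v} [Preorder A] [IsDirectedOrder A] [Nonempty A]
    {x : A → X} {l : X} : UOConverges x l ↔
      ∀ y : X, 0 ≤ y → IsGLB {d | ∃ a₀ : A, ∀ a, a₀ ≤ a → |x a - l| ⊓ y ≤ d} 0 := by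
  refine forall₂_congr fun y hy => ?_
  have h0 : ∀ a, 0 ≤ |x a - l| ⊓ y := fun a => le_inf (abs_nonneg _) hy
  have habs : ∀ a, |0 - |x a - l| ⊓ y| = |x a - l| ⊓ y := fun a => by
    rw [zero_sub, abs_neg, abs_of_nonneg (h0 a)]
  constructor
  · rintro ⟨B, _, _, _, v, -, hg, hb⟩
    refine ⟨fun d ⟨a₀, h⟩ => (h0 a₀).trans (h a₀ le_rfl), fun c hc => hg.2 ?_⟩
    rintro _ ⟨b, rfl⟩
    obtain ⟨a₀, h⟩ := hb b
    exact hc ⟨a₀, fun a ha => (habs a).symm.trans_le (h a ha)⟩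
  · intro hg
    set D := {d | ∃ a₀ : A, ∀ a, a₀ ≤ a → |x a - l| ⊓ y ≤ d}
    refine ⟨(↥D)ᵒᵈ, inferInstance, ⟨?_⟩, ?_, fun b => (OrderDual.ofDual b).1, ?_, ?_, ?_⟩
    · rintro ⟨a, i, hi⟩ ⟨b, j, hj⟩
      obtain ⟨k, hik, hjk⟩ := exists_ge_ge i j
      exact ⟨OrderDual.toDual ⟨a ⊓ b, k, fun c hc =>
        le_inf (hi c (hik.trans hc)) (hj c (hjk.trans hc))⟩,
        (inf_le_left : a ⊓ b ≤ a), (inf_le_right : a ⊓ b ≤ b)⟩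
    · obtain ⟨a⟩ := ‹Nonempty A›
      exact ⟨OrderDual.toDual ⟨y, a, fun _ _ => inf_le_right⟩⟩
    · exact fun a b h => h
    · convert hg
      ext d
      exact ⟨fun ⟨b, hb⟩ => hb ▸ (OrderDual.ofDual b).2, fun hd => ⟨OrderDual.toDual ⟨d, hd⟩, rfl⟩⟩
    · rintro ⟨d, a₀, h⟩
      exact ⟨a₀, fun a ha => (habs a).trans_le (h a ha)⟩

end LatticeGroup

section Space

variable {E : Type u} [ConditionallyCompleteLattice E] [AddCommGroup E] [IsOrderedAddMonoid E]
  [Module ℝ E] [PosSMulMono ℝ E]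

/-- A Dedekind complete vector lattice is Archimedean. -/
lemma nonpos_of_forall_natCast_smul_le {x y : E} (h : ∀ n : ℕ, (n : ℝ) • x ≤ y) : x ≤ 0 := by
  have hb : BddAbove (range fun n : ℕ => (n : ℝ) • x) := ⟨y, by rintro _ ⟨n, rfl⟩; exact h n⟩
  have hl := isLUB_csSup (range_nonempty _) hb
  have h1 : sSup (range fun n : ℕ => (n : ℝ) • x) ≤ sSup (range fun n : ℕ => (n : ℝ) • x) - x := by
    refine hl.2 ?_
    rintro _ ⟨n, rfl⟩
    rw [le_sub_iff_add_le]
    refine le_trans (le_of_eq ?_) (hl.1 ⟨n + 1, rfl⟩)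
    push_cast
    rw [add_smul, one_smul]
  simpa using h1

lemma abs_smul_le (r : ℝ) (x : E) : |r • x| ≤ |r| • |x| := by
  have h1 : ∀ y : E, |r| • y ≤ |r| • |y| := fun y =>
    smul_le_smul_of_nonneg_left (le_abs_self y) (abs_nonneg r)
  have h2 := h1 x
  have h3 := h1 (-x)
  rw [abs_neg, smul_neg] at h3
  rcases abs_choice r with hr | hr <;> rw [hr] at h2 h3 ⊢
  · exact abs_le'.2 ⟨h2, h3⟩
  · rw [neg_smul, neg_smul, neg_neg] at h3
    rw [neg_smul, neg_smul] at h2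
    rw [neg_smul]
    exact abs_le'.2 ⟨h3, h2⟩

lemma smul_pos_of_pos {r : ℝ} {x : E} (hr : 0 < r) (hx : 0 < x) : 0 < r • x := by
  refine (smul_nonneg hr.le hx.le).lt_of_ne fun h => hx.ne' ?_
  rw [← inv_smul_smul₀ hr.ne' x, ← h, smul_zero]

/-! ### Disjoint complements and bands -/

/-- The disjoint complement of a vector. -/
def disjCompl (w : E) : Submodule ℝ E where
  carrier := {s | |s| ⊓ |w| = 0}
  zero_mem' := by simp
  add_mem' := by
    intro s t hs ht
    refine le_antisymm ?_ (le_inf (abs_nonneg _) (abs_nonneg _))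
    refine (inf_le_inf_right _ (abs_add_le s t)).trans ?_
    refine (add_inf_le_inf_add_inf (abs_nonneg _) (abs_nonneg _) (abs_nonneg _)).trans ?_
    rw [hs, ht, add_zero]
  smul_mem' := by
    intro r s hs
    have key : ∀ n : ℕ, ((n : ℝ) • |s|) ⊓ |w| = 0 := by
      intro n
      induction n with
      | zero => simp
      | succ n ih =>
        refine le_antisymm ?_
          (le_inf (smul_nonneg (Nat.cast_nonneg _) (abs_nonneg _)) (abs_nonneg _))
        push_cast
        rw [add_smul, one_smul]
        refine (add_inf_le_inf_add_inf (smul_nonneg (Nat.cast_nonneg _) (abs_nonneg _))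
          (abs_nonneg _) (abs_nonneg _)).trans ?_
        rw [ih, hs, add_zero]
    obtain ⟨n, hn⟩ := exists_nat_ge |r|
    refine le_antisymm (le_trans (inf_le_inf_right _ ?_) (key n).le)
      (le_inf (abs_nonneg _) (abs_nonneg _))
    exact (abs_smul_le r s).trans (smul_le_smul_of_nonneg_right hn (abs_nonneg s))

lemma mem_disjCompl {s w : E} : s ∈ disjCompl w ↔ |s| ⊓ |w| = 0 := Iff.rfl

lemma mem_disjCompl_comm {s w : E} : s ∈ disjCompl w ↔ w ∈ disjCompl s := by
  rw [mem_disjCompl, mem_disjCompl, inf_comm]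

lemma mem_disjCompl_of_abs_le {s t w : E} (h : |s| ≤ |t|) (ht : t ∈ disjCompl w) :
    s ∈ disjCompl w :=
  le_antisymm ((inf_le_inf_right _ h).trans (mem_disjCompl.1 ht).le)
    (le_inf (abs_nonneg _) (abs_nonneg _))

lemma mem_disjCompl_of_le {s t w : E} (hs : 0 ≤ s) (h : s ≤ t) (ht : t ∈ disjCompl w) :
    s ∈ disjCompl w :=
  mem_disjCompl_of_abs_le (by rwa [abs_of_nonneg hs, abs_of_nonneg (hs.trans h)]) ht

lemma mem_disjCompl_anti {s w w' : E} (hw : 0 ≤ w') (h : w' ≤ w) (hs : s ∈ disjCompl w) :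
    s ∈ disjCompl w' :=
  mem_disjCompl_comm.1 (mem_disjCompl_of_le hw h (mem_disjCompl_comm.1 hs))

lemma mem_disjCompl_iff {s w : E} (hs : 0 ≤ s) (hw : 0 ≤ w) : s ∈ disjCompl w ↔ s ⊓ w = 0 := by
  rw [mem_disjCompl, abs_of_nonneg hs, abs_of_nonneg hw]

lemma abs_mem_disjCompl {s w : E} : |s| ∈ disjCompl w ↔ s ∈ disjCompl w := by
  rw [mem_disjCompl, mem_disjCompl, abs_abs]

lemma eq_zero_of_mem_disjCompl_self {w : E} (h : w ∈ disjCompl w) : w = 0 := by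
  rw [mem_disjCompl, inf_idem] at h
  exact le_antisymm (h ▸ le_abs_self w) (neg_nonpos.1 (h ▸ neg_le_abs w))

lemma posPart_mem_disjCompl_negPart (x : E) : x⁺ ∈ disjCompl x⁻ :=
  (mem_disjCompl_iff (posPart_nonneg x) (negPart_nonneg x)).2 (posPart_inf_negPart_eq_zero x)

lemma isBand_disjCompl (w : E) : IsBand (disjCompl w) where
  solid _ _ h hy := mem_disjCompl_of_abs_le h hy
  isLUB_mem D s hD hs := by
    rcases D.eq_empty_or_nonempty with rfl | ⟨t, ht⟩
    · -- the zero space is the only one that has a least element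
      have h1 : ∀ x, s ≤ x := fun x => hs.2 (by simp)
      have h2 : s = 0 := le_antisymm (h1 0) (by simpa using h1 (s + s))
      rw [h2]
      exact zero_mem _
    have h1 : s ⊓ |w| ≤ 0 := inf_le_of_isLUB hs fun t ht =>
      (inf_le_inf_right _ (le_abs_self t)).trans (mem_disjCompl.1 (hD ht)).le
    have hpos : s⁺ ∈ disjCompl w := by
      rw [mem_disjCompl, abs_of_nonneg (posPart_nonneg s)]
      refine le_antisymm ?_ (le_inf (posPart_nonneg s) (abs_nonneg w))
      let _ := AddCommGroup.toDistribLattice E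
      rw [posPart_def, inf_sup_right]
      exact sup_le h1 inf_le_left
    have hneg : s⁻ ∈ disjCompl w := by
      refine mem_disjCompl_of_le (t := |t|) (negPart_nonneg s) ?_ (abs_mem_disjCompl.2 (hD ht))
      exact sup_le ((neg_le_neg (hs.1 ht)).trans (neg_le_abs t)) (abs_nonneg t)
    rw [← posPart_sub_negPart s]
    exact sub_mem hpos hneg

/-- Every band is the intersection of the disjoint complements that contain it. -/
lemma IsBand.mem_of_forall_disjCompl {B : Submodule ℝ E} (hB : IsBand B) {v : E}
    (h : ∀ y : E, (∀ b ∈ B, b ∈ disjCompl y) → v ∈ disjCompl y) : v ∈ B := by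
  refine hB.solid (y := |v|) (by rw [abs_abs]) ?_
  set D := {b : E | b ∈ B ∧ b ≤ |v|}
  have hs : IsLUB D (sSup D) :=
    isLUB_csSup ⟨0, zero_mem B, abs_nonneg v⟩ ⟨|v|, fun b hb => hb.2⟩
  set s := sSup D
  have hsB : s ∈ B := hB.isLUB_mem (fun b hb => hb.1) hs
  have hsv : 0 ≤ |v| - s := sub_nonneg.2 (hs.2 fun b hb => hb.2)
  have hs0 : 0 ≤ s := hs.1 ⟨zero_mem B, abs_nonneg v⟩
  -- by maximality of `s`, the remainder `|v| - s` is disjoint from `B`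
  have h1 : ∀ b ∈ B, b ∈ disjCompl (|v| - s) := by
    intro b hb
    rw [mem_disjCompl, abs_of_nonneg hsv]
    have h0 : 0 ≤ |b| ⊓ (|v| - s) := le_inf (abs_nonneg b) hsv
    refine le_antisymm ?_ h0
    have hm : |b| ⊓ (|v| - s) ∈ B := hB.solid (y := b) (by
      rw [abs_of_nonneg h0]; exact inf_le_left) hb
    have h2 : s + |b| ⊓ (|v| - s) ≤ s := hs.1 ⟨add_mem hsB hm, by
      rw [← le_sub_iff_add_le']; exact inf_le_right⟩
    simpa using h2
  have h2 : |v| - s ∈ disjCompl (|v| - s) :=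
    mem_disjCompl_of_le hsv (sub_le_self _ hs0) (abs_mem_disjCompl.2 (h _ h1))
  rw [sub_eq_zero.1 (eq_zero_of_mem_disjCompl_self h2)]
  exact hsB

/-! ### Unbounded order convergence as a local condition -/

/-- A net, meant to consist of positive vectors, is locally null when every `z > 0`
dominates it eventually on some nonzero part `w` of `z`: the excess over `z` is disjoint from `w`. -/
def LocallyNull {A : Type v} [Preorder A] (u : A → E) : Prop :=
  ∀ z : E, 0 < z → ∃ w, 0 < w ∧ w ≤ z ∧ ∃ a₀ : A, ∀ a, a₀ ≤ a → (u a - z)⁺ ∈ disjCompl w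

variable {A : Type v} [Preorder A]

lemma LocallyNull.mono {u v : A → E} (hv : LocallyNull v) (h : ∀ a, u a ≤ v a) :
    LocallyNull u := by
  intro z hz
  obtain ⟨w, hw, hwz, a₀, ha⟩ := hv z hz
  exact ⟨w, hw, hwz, a₀, fun a h' => mem_disjCompl_of_le (posPart_nonneg _)
    (posPart_mono (sub_le_sub_right (h a) z)) (ha a h')⟩

lemma inv_two_smul_spec {z : E} (hz : 0 < z) : 0 < (2⁻¹ : ℝ) • z ∧ (2⁻¹ : ℝ) • z ≤ z ∧
    (2⁻¹ : ℝ) • z + (2⁻¹ : ℝ) • z = z := by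
  have h2 : (2⁻¹ : ℝ) • z + (2⁻¹ : ℝ) • z = z := by rw [← add_smul]; norm_num
  have h0 : 0 ≤ (2⁻¹ : ℝ) • z := smul_nonneg (by norm_num) hz.le
  refine ⟨smul_pos_of_pos (by norm_num) hz, ?_, h2⟩
  conv_rhs => rw [← h2]
  exact le_add_of_nonneg_right h0

lemma LocallyNull.add [IsDirectedOrder A] {u v : A → E} (hu : LocallyNull u)
    (hv : LocallyNull v) : LocallyNull (fun a => u a + v a) := by
  intro z hz
  obtain ⟨hh, hhz, e⟩ := inv_two_smul_spec hz
  obtain ⟨w₁, hw₁, hw₁h, a₁, ha₁⟩ := hu _ hh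
  obtain ⟨w₂, hw₂, hw₂w₁, a₂, ha₂⟩ := hv w₁ hw₁
  obtain ⟨a₀, h1, h2⟩ := exists_ge_ge a₁ a₂
  refine ⟨w₂, hw₂, hw₂w₁.trans (hw₁h.trans hhz), a₀, fun a ha => ?_⟩
  refine mem_disjCompl_of_le (posPart_nonneg _) ?_ (add_mem
    (mem_disjCompl_anti hw₂.le hw₂w₁ (ha₁ a (h1.trans ha))) (ha₂ a (h2.trans ha)))
  refine le_trans (posPart_mono ?_) (posPart_add_le _ _)
  have : u a + v a - z = (u a - (2⁻¹ : ℝ) • z) + (v a - (2⁻¹ : ℝ) • z) := by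
    conv_lhs => rw [← e]
    abel
  rw [this]
  exact add_le_add_right (sub_le_sub_left hw₁h _) _

lemma LocallyNull.comp_fst {B : Type*} [Preorder B] [Nonempty B] {u : A → E}
    (hu : LocallyNull u) : LocallyNull (fun p : A × B => u p.1) := by
  intro z hz
  obtain ⟨w, hw, hwz, a₀, ha⟩ := hu z hz
  obtain ⟨b⟩ := ‹Nonempty B›
  exact ⟨w, hw, hwz, (a₀, b), fun p hp => ha _ hp.1⟩

lemma LocallyNull.comp_snd {B : Type*} [Preorder B] [Nonempty B] {u : A → E}
    (hu : LocallyNull u) : LocallyNull (fun p : B × A => u p.2) := by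
  intro z hz
  obtain ⟨w, hw, hwz, a₀, ha⟩ := hu z hz
  obtain ⟨b⟩ := ‹Nonempty B›
  exact ⟨w, hw, hwz, (b, a₀), fun p hp => ha _ hp.2⟩

/-- If `u ⊓ 2x` is order null then `u` is locally small on the part below `x`. -/
lemma exists_posPart_sub_mem_disjCompl {u : A → E} {z x : E} {D : Set E} (hz : 0 < z)
    (hzx : z ≤ x) (hD : IsGLB D 0) (h : ∀ d ∈ D, ∃ a₀, ∀ a, a₀ ≤ a → u a ⊓ (x + x) ≤ d) :
    ∃ w, 0 < w ∧ w ≤ z ∧ ∃ a₀ : A, ∀ a, a₀ ≤ a → (u a - z)⁺ ∈ disjCompl w := by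
  obtain ⟨d, hdD, hd⟩ : ∃ d ∈ D, ¬ z ≤ d := by
    by_contra! hc
    exact hz.not_ge (hD.2 hc)
  obtain ⟨a₀, ha⟩ := h d hdD
  have hwz : (z - d)⁺ ≤ z := sup_le (sub_le_self _ (hD.1 hdD)) hz.le
  refine ⟨(z - d)⁺, (posPart_nonneg _).lt_of_ne fun h0 => hd ?_, hwz, a₀, fun a h' => ?_⟩
  · exact sub_nonpos.1 (posPart_eq_zero.1 h0.symm)
  · rw [mem_disjCompl_iff (posPart_nonneg _) (posPart_nonneg _)]
    refine le_antisymm ?_ (le_inf (posPart_nonneg _) (posPart_nonneg _))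
    rw [← posPart_inf_negPart_eq_zero (z - d), inf_comm (z - d)⁺]
    refine le_inf ((posPart_inf_sub _ _ _ hwz).trans ?_) inf_le_right
    rw [← posPart_neg, neg_sub]
    exact posPart_mono (sub_le_sub_right
      ((inf_le_inf_left _ (add_le_add hzx hzx)).trans (ha a h')) _)

lemma uoConverges_iff_locallyNull [IsDirectedOrder A] [Nonempty A] {x : A → E} {l : E} :
    UOConverges x l ↔ LocallyNull (fun a => |x a - l|) := by
  rw [uoConverges_iff_isGLB]
  constructor
  · intro h z hz
    exact exists_posPart_sub_mem_disjCompl hz le_rfl (h (z + z) (add_nonneg hz.le hz.le))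
      fun d hd => hd
  · intro h y hy
    have h0 : ∀ a, 0 ≤ |x a - l| ⊓ y := fun a => le_inf (abs_nonneg _) hy
    have hD0 : ∀ d, (∃ a₀ : A, ∀ a, a₀ ≤ a → |x a - l| ⊓ y ≤ d) → 0 ≤ d :=
      fun d ⟨a₀, h⟩ => (h0 a₀).trans (h a₀ le_rfl)
    refine ⟨hD0, fun c hc => ?_⟩
    rw [← posPart_eq_zero]
    by_contra hne
    have hz : 0 < c⁺ := (posPart_nonneg c).lt_of_ne (Ne.symm hne)
    have hzD : ∀ d, (∃ a₀ : A, ∀ a, a₀ ≤ a → |x a - l| ⊓ y ≤ d) → c⁺ ≤ d :=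
      fun d hd => sup_le (hc hd) (hD0 d hd)
    set z := c⁺
    obtain ⟨hh, hhz, e⟩ := inv_two_smul_spec hz
    obtain ⟨w, hw, hwh, a₀, ha⟩ := h _ hh
    set k := (2⁻¹ : ℝ) • z
    -- `z` lies below the supremum of a tail of the net, but the infimum of each of its terms
    -- with `z` is at most `z - w`
    set S := (fun a => |x a - l| ⊓ y) '' Ici a₀
    have hS : IsLUB S (sSup S) := isLUB_csSup ⟨_, a₀, self_mem_Ici, rfl⟩
      ⟨y, by rintro _ ⟨a, -, rfl⟩; exact inf_le_right⟩
    have hzS : z ≤ sSup S := hzD _ ⟨a₀, fun a h' => hS.1 ⟨a, h', rfl⟩⟩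
    have key : sSup S ⊓ z ≤ z - w := by
      refine inf_le_of_isLUB hS ?_
      rintro _ ⟨a, h', rfl⟩
      rw [le_sub_iff_add_le]
      have h1 : |x a - l| ⊓ y ⊓ z ≤ k + (|x a - l| - k)⁺ ⊓ k := by
        rw [← sub_le_iff_le_add']
        refine le_inf (le_trans ?_ (le_posPart _)) ?_
        · exact sub_le_sub_right (inf_le_left.trans inf_le_left) _
        · rw [sub_le_iff_le_add, e]
          exact inf_le_right
      have h2 : (|x a - l| - k)⁺ ⊓ k + w ≤ k := by
        have hd : ((|x a - l| - k)⁺ ⊓ k) ⊓ w = 0 := by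
          rw [← mem_disjCompl_iff (le_inf (posPart_nonneg _) hh.le) hw.le]
          exact mem_disjCompl_of_le (le_inf (posPart_nonneg _) hh.le) inf_le_left (ha a h')
        rw [← inf_add_sup, hd, zero_add]
        exact sup_le inf_le_right hwh
      calc |x a - l| ⊓ y ⊓ z + w ≤ k + (|x a - l| - k)⁺ ⊓ k + w := add_le_add_left h1 w
        _ = k + ((|x a - l| - k)⁺ ⊓ k + w) := add_assoc _ _ _
        _ ≤ k + k := add_le_add_right h2 k
        _ = z := e
    rw [inf_eq_right.2 hzS] at key
    exact hw.not_ge (by simpa using key)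

end Space

/-! ### Operators and disjointness -/

section Operators

variable {E : Type u} [ConditionallyCompleteLattice E] [AddCommGroup E] [IsOrderedAddMonoid E]
  [Module ℝ E] [PosSMulMono ℝ E]

/-- An operator is an orthomorphism exactly when it leaves disjoint complements invariant. -/
lemma mem_Orth_iff {T : Lb E} :
    T ∈ Orth E ↔ ∀ x w : E, x ∈ disjCompl w → T x ∈ disjCompl w := by
  refine ⟨fun h x w hx => h _ (isBand_disjCompl w) x hx, fun h B hB x hx => ?_⟩
  exact hB.mem_of_forall_disjCompl fun y hy => h x y (hy x hx)

lemma Lb.apply_eq_posPart_sub (T : Lb E) (x : E) : T x = T x⁺ - T x⁻ := by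
  rw [← map_sub, posPart_sub_negPart]

lemma Lb.apply_nonneg {T : Lb E} (hT : 0 ≤ T) {x : E} (hx : 0 ≤ x) : 0 ≤ T x := hT x hx

lemma Lb.apply_mono {T : Lb E} (hT : 0 ≤ T) {x y : E} (h : x ≤ y) : T x ≤ T y := by
  rw [← sub_nonneg, ← map_sub]
  exact hT _ (sub_nonneg.2 h)

lemma Lb.abs_apply_le (T : Lb E) (x : E) : |T x| ≤ |T| |x| := by
  have h1 : ∀ y : E, T y ≤ |T| |y| := by
    intro y
    have e : |y| = y⁺ + y⁻ := (posPart_add_negPart y).symm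
    rw [T.apply_eq_posPart_sub, e, map_add, sub_eq_add_neg]
    exact add_le_add (le_abs_self T _ (posPart_nonneg y)) (neg_le_abs T _ (negPart_nonneg y))
  refine abs_le'.2 ⟨h1 x, ?_⟩
  rw [← map_neg, ← abs_neg x]
  exact h1 (-x)

/-! ### The lattice operations of orthomorphisms -/

/-- A positive vector can be shrunk so that each of finitely many vectors has a constant sign on
what is left. -/
lemma exists_le_forall_mem_disjCompl (f : ℕ → E) (n : ℕ) {w : E} (hw : 0 < w) :
    ∃ w', 0 < w' ∧ w' ≤ w ∧ ∀ i < n, (f i)⁺ ∈ disjCompl w' ∨ (f i)⁻ ∈ disjCompl w' := by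
  induction n with
  | zero => exact ⟨w, hw, le_rfl, by simp⟩
  | succ n ih =>
    obtain ⟨v, hv, hvw, h⟩ := ih
    by_cases hd : (f n)⁺ ∈ disjCompl v
    · refine ⟨v, hv, hvw, fun i hi => ?_⟩
      rcases Nat.lt_succ_iff_lt_or_eq.1 hi with hi | rfl
      · exact h i hi
      · exact Or.inl hd
    · have h0 : 0 ≤ (f n)⁺ ⊓ v := le_inf (posPart_nonneg _) hv.le
      refine ⟨(f n)⁺ ⊓ v, h0.lt_of_ne fun hc => hd ?_, inf_le_right.trans hvw, fun i hi => ?_⟩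
      · exact (mem_disjCompl_iff (posPart_nonneg _) hv.le).2 hc.symm
      · rcases Nat.lt_succ_iff_lt_or_eq.1 hi with hi | rfl
        · exact (h i hi).imp (mem_disjCompl_anti h0 inf_le_right)
            (mem_disjCompl_anti h0 inf_le_right)
        · exact Or.inr (mem_disjCompl_anti h0 inf_le_left
            (mem_disjCompl_comm.1 (posPart_mem_disjCompl_negPart _)))

/-- The multiples `(i / N) x` of `x` cut the interval `[0, x]` into `N` cells; every positive
vector has a nonzero part on which `z` lies in a single cell. -/
lemma exists_cell {x z w : E} (hz : 0 ≤ z) (hzx : z ≤ x) (hw : 0 < w) {N : ℕ} (hN : 0 < N) :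
    ∃ w', 0 < w' ∧ w' ≤ w ∧ ∃ i < N, (z - ((i : ℝ) / N) • x)⁻ ∈ disjCompl w' ∧
      (z - (((i + 1 : ℕ) : ℝ) / N) • x)⁺ ∈ disjCompl w' := by
  obtain ⟨v, hv, hvw, h⟩ := exists_le_forall_mem_disjCompl
    (fun i : ℕ => z - ((i : ℝ) / N) • x) (N + 1) hw
  refine ⟨v, hv, hvw, ?_⟩
  by_contra! hc
  have key : ∀ i ≤ N, (z - ((i : ℝ) / N) • x)⁻ ∈ disjCompl v := by
    intro i hi
    induction i with
    | zero =>
      have : (z - (((0 : ℕ) : ℝ) / N) • x)⁻ = 0 := by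
        rw [negPart_eq_zero]
        simpa using hz
      rw [this]
      exact zero_mem _
    | succ i ih =>
      exact (h (i + 1) (by omega)).resolve_left (hc i (by omega) (ih (by omega)))
  refine hc (N - 1) (by omega) (key _ (by omega)) ?_
  have hN' : (N : ℝ) ≠ 0 := by exact_mod_cast hN.ne'
  rw [Nat.sub_add_cancel hN, div_self hN', one_smul, posPart_eq_zero.2 (sub_nonpos.2 hzx)]
  exact zero_mem _

/-- The estimate behind the pointwise formula for the positive part: on each cell `z` is a multiple
`c x` with `0 ≤ c ≤ 1`, up to an error of at most `x / N`, on which `T` is bounded by `m / N`. -/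
lemma Orth.apply_le_posPart_add {T : Lb E} (hT : T ∈ Orth E) {x z m : E} (hz : 0 ≤ z)
    (hzx : z ≤ x) (hm : ∀ r, 0 ≤ r → r ≤ x → T r ≤ m) {N : ℕ} (hN : 0 < N) :
    T z ≤ (T x)⁺ + (N : ℝ)⁻¹ • m := by
  rw [mem_Orth_iff] at hT
  have hNpos : (0 : ℝ) < N := by exact_mod_cast hN
  have hx : 0 ≤ x := hz.trans hzx
  rw [← sub_nonpos, ← posPart_eq_zero]
  by_contra hne
  obtain ⟨w, hw, hw', i, hi, h1, h2⟩ := exists_cell hz hzx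
    ((posPart_nonneg _).lt_of_ne (Ne.symm hne)) hN
  set c : ℝ := (i : ℝ) / N with hc
  have hc0 : 0 ≤ c := by positivity
  have hc1 : c ≤ 1 := by
    rw [hc, div_le_one hNpos]
    exact_mod_cast hi.le
  set y : E := (N : ℝ)⁻¹ • x with hy
  have hy0 : 0 ≤ y := smul_nonneg (by positivity) hx
  set p := (z - c • x)⁺ with hp
  set q := (z - c • x)⁻
  -- on `w`, the vector `z` is `c x` up to the remainder `r ≤ x / N`
  set r := p ⊓ y
  have hr0 : 0 ≤ r := le_inf (posPart_nonneg _) hy0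
  have hpr : p - r ∈ disjCompl w := by
    have e1 : p - r = (p - y)⁺ := by
      change p - p ⊓ y = _
      rw [posPart_def, sub_inf, sub_self, sup_comm]
    have e2 : p - y ≤ (z - (((i + 1 : ℕ) : ℝ) / N) • x)⁺ := by
      have e3 : z - (((i + 1 : ℕ) : ℝ) / N) • x = (z - c • x) - y := by
        rw [sub_sub, hy, ← add_smul]
        congr 3
        push_cast
        rw [hc]
        ring
      rw [e3, hp, sub_le_iff_le_add]
      refine sup_le ?_ (add_nonneg (posPart_nonneg _) hy0)
      rw [← sub_le_iff_le_add]
      exact le_posPart _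
    rw [e1]
    exact mem_disjCompl_of_le (posPart_nonneg _) (sup_le e2 (posPart_nonneg _)) h2
  have hTr : T r ≤ (N : ℝ)⁻¹ • m := by
    have e : r = (N : ℝ)⁻¹ • ((N : ℝ) • r) := by
      rw [smul_smul, inv_mul_cancel₀ hNpos.ne', one_smul]
    rw [e, map_smul]
    refine smul_le_smul_of_nonneg_left (hm _ (smul_nonneg hNpos.le hr0) ?_) (by positivity)
    have := smul_le_smul_of_nonneg_left (inf_le_right : p ⊓ y ≤ y) hNpos.le
    rwa [hy, smul_smul, mul_inv_cancel₀ hNpos.ne', one_smul] at this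
  have hs : T (p - r) - T q ∈ disjCompl w := sub_mem (hT _ _ hpr) (hT _ _ h1)
  have hTz : T z = c • T x + T r + (T (p - r) - T q) := by
    have e : z = c • x + (p - q) := by rw [posPart_sub_negPart]; abel
    conv_lhs => rw [e]
    rw [map_add, map_smul, map_sub, map_sub]
    abel
  have hcT : c • T x ≤ (T x)⁺ :=
    (smul_le_smul_of_nonneg_left (le_posPart _) hc0).trans
      ((smul_le_smul_of_nonneg_right hc1 (posPart_nonneg _)).trans (one_smul _ _).le)
  have hfin : T z - ((T x)⁺ + (N : ℝ)⁻¹ • m) ≤ T (p - r) - T q := by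
    rw [hTz, sub_le_iff_le_add, add_comm (T (p - r) - T q)]
    exact add_le_add_left (add_le_add hcT hTr) _
  have hwabs : w ≤ |T (p - r) - T q| :=
    hw'.trans (sup_le (hfin.trans (le_abs_self _)) (abs_nonneg _))
  exact hw.ne' (eq_zero_of_mem_disjCompl_self
    (mem_disjCompl_of_le hw.le hwabs (abs_mem_disjCompl.2 hs)))

/-- The positive part of an orthomorphism is computed pointwise on positive vectors. -/
lemma Orth.pos_apply {T : Lb E} (hT : T ∈ Orth E) {x : E} (hx : 0 ≤ x) : T.pos x = (T x)⁺ := by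
  refine le_antisymm ?_ (sup_le (T.isLUB_pos.1 (mem_insert _ _) x hx)
    (T.isLUB_pos.1 (mem_insert_of_mem _ rfl) x hx))
  rw [Lb.pos_apply T hx]
  refine rk_le T hx fun z hz hzx => ?_
  obtain ⟨m, hm⟩ := (T.2 0 x).1
  have hm' : ∀ r, 0 ≤ r → r ≤ x → T r ≤ m := fun r h0 h1 => hm ⟨r, ⟨h0, h1⟩, rfl⟩
  rw [← sub_nonpos]
  refine nonpos_of_forall_natCast_smul_le (y := m) fun N => ?_
  rcases N.eq_zero_or_pos with rfl | hN
  · simpa using hm' 0 le_rfl hx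
  · have hNpos : (0 : ℝ) < N := by exact_mod_cast hN
    have h := smul_le_smul_of_nonneg_left
      (sub_le_iff_le_add'.2 (Orth.apply_le_posPart_add hT hz hzx hm' hN)) hNpos.le
    rwa [smul_smul, mul_inv_cancel₀ hNpos.ne', one_smul] at h

lemma Orth.sup_apply {S T : Lb E} (hS : S ∈ Orth E) (hT : T ∈ Orth E) {x : E} (hx : 0 ≤ x) :
    (S ⊔ T) x = S x ⊔ T x := by
  change (T + (S - T).pos) x = _
  rw [Lb.add_apply, Orth.pos_apply (sub_mem hS hT) hx, Lb.sub_apply, posPart_def, add_sup]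
  simp

lemma Orth.inf_apply {S T : Lb E} (hS : S ∈ Orth E) (hT : T ∈ Orth E) {x : E} (hx : 0 ≤ x) :
    (S ⊓ T) x = S x ⊓ T x := by
  have h : S ⊓ T = S + T - (S ⊔ T) := by rw [← inf_add_sup S T, add_sub_cancel_right]
  rw [h, Lb.sub_apply, Lb.add_apply, Orth.sup_apply hS hT hx, ← inf_add_sup, add_sub_cancel_right]

lemma Orth.abs_apply {T : Lb E} (hT : T ∈ Orth E) {x : E} (hx : 0 ≤ x) : |T| x = |T x| :=
  Orth.sup_apply hT (neg_mem hT) hx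

lemma mem_Orth_of_forall_nonneg {T : Lb E}
    (h : ∀ x w : E, 0 ≤ x → x ∈ disjCompl w → T x ∈ disjCompl w) : T ∈ Orth E := by
  refine mem_Orth_iff.2 fun x w hx => ?_
  have hx' := abs_mem_disjCompl.2 hx
  rw [T.apply_eq_posPart_sub]
  refine sub_mem (h _ _ (posPart_nonneg x) ?_) (h _ _ (negPart_nonneg x) ?_)
  · exact mem_disjCompl_of_le (posPart_nonneg x) (sup_le (le_abs_self x) (abs_nonneg x)) hx'
  · exact mem_disjCompl_of_le (negPart_nonneg x) (sup_le (neg_le_abs x) (abs_nonneg x)) hx'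

lemma mem_Orth_of_abs {T : Lb E} (h : |T| ∈ Orth E) : T ∈ Orth E :=
  mem_Orth_of_forall_nonneg fun x w hx hxw =>
    mem_disjCompl_of_abs_le (by
      refine (T.abs_apply_le x).trans ?_
      rw [abs_of_nonneg hx]
      exact le_abs_self _) (mem_Orth_iff.1 h x w hxw)

lemma Orth.sup_mem {S T : Lb E} (hS : S ∈ Orth E) (hT : T ∈ Orth E) : S ⊔ T ∈ Orth E := by
  refine mem_Orth_of_forall_nonneg fun x w hx hxw => ?_
  have h1 := mem_Orth_iff.1 hS x w hxw
  have h2 := mem_Orth_iff.1 hT x w hxw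
  rw [Orth.sup_apply hS hT hx, sup_eq_add_posPart_sub]
  have h3 := sub_mem h1 h2
  exact add_mem h2 (mem_disjCompl_of_le (posPart_nonneg _)
    (sup_le (le_abs_self _) (abs_nonneg _)) (abs_mem_disjCompl.2 h3))

lemma Orth.abs_mem {T : Lb E} (hT : T ∈ Orth E) : |T| ∈ Orth E := Orth.sup_mem hT (neg_mem hT)

lemma Orth.mem_of_nonneg_of_le {S T : Lb E} (hT : T ∈ Orth E) (h0 : 0 ≤ S) (h : S ≤ T) :
    S ∈ Orth E :=
  mem_Orth_of_forall_nonneg fun x w hx hxw =>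
    mem_disjCompl_of_le (h0 x hx) (h x hx) (mem_Orth_iff.1 hT x w hxw)

/-! ### Infima and suprema of sets of operators -/

/-- A function that is additive and positively homogeneous on the positive cone extends to a
linear operator. -/
lemma exists_end_of_cone (g : E → E)
    (hadd : ∀ x y : E, 0 ≤ x → 0 ≤ y → g (x + y) = g x + g y)
    (hsmul : ∀ (r : ℝ) (x : E), 0 ≤ r → 0 ≤ x → g (r • x) = r • g x) :
    ∃ G : Module.End ℝ E, ∀ x, 0 ≤ x → G x = g x := by
  have hsub : ∀ {a b c d : E}, 0 ≤ a → 0 ≤ b → 0 ≤ c → 0 ≤ d → a - b = c - d →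
      g a - g b = g c - g d := by
    intro a b c d ha hb hc hd h
    rw [sub_eq_sub_iff_add_eq_add] at h ⊢
    rw [← hadd _ _ ha hd, ← hadd _ _ hc hb, h]
  have hp := fun x : E => posPart_nonneg x
  have hn := fun x : E => negPart_nonneg x
  refine ⟨{ toFun := fun x => g x⁺ - g x⁻, map_add' := fun x y => ?_,
            map_smul' := fun r x => ?_ }, fun x hx => ?_⟩
  · rw [hsub (hp _) (hn _) (add_nonneg (hp x) (hp y)) (add_nonneg (hn x) (hn y)),
      hadd _ _ (hp x) (hp y), hadd _ _ (hn x) (hn y), add_sub_add_comm]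
    rw [posPart_sub_negPart, add_sub_add_comm, posPart_sub_negPart, posPart_sub_negPart]
  · simp only [RingHom.id_apply]
    rcases le_total 0 r with hr | hr
    · rw [hsub (hp _) (hn _) (smul_nonneg hr (hp x)) (smul_nonneg hr (hn x)),
        hsmul r _ hr (hp x), hsmul r _ hr (hn x), smul_sub]
      rw [posPart_sub_negPart, ← smul_sub, posPart_sub_negPart]
    · have hr' : 0 ≤ -r := by linarith
      rw [hsub (hp _) (hn _) (smul_nonneg hr' (hn x)) (smul_nonneg hr' (hp x)),
        hsmul _ _ hr' (hn x), hsmul _ _ hr' (hp x), neg_smul, neg_smul, smul_sub]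
      · abel
      · rw [posPart_sub_negPart, neg_smul, neg_smul, neg_sub_neg, ← smul_sub, posPart_sub_negPart]
  · have h0 : g 0 = 0 := by simpa using hsmul 0 0 le_rfl le_rfl
    change g x⁺ - g x⁻ = g x
    rw [posPart_of_nonneg hx, negPart_of_nonneg hx, h0, sub_zero]

/-- The infimum of a downward directed set of operators exists and is computed pointwise on
positive vectors. -/
lemma exists_isGLB_of_directed {D : Set (Lb E)} (hne : D.Nonempty)
    (hdir : ∀ S ∈ D, ∀ T ∈ D, ∃ R ∈ D, R ≤ S ∧ R ≤ T) (hb : BddBelow D) :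
    ∃ G : Lb E, IsGLB D G ∧ ∀ x, 0 ≤ x → IsGLB ((fun T : Lb E => T x) '' D) (G x) := by
  obtain ⟨L, hL⟩ := hb
  set g : E → E := fun x => sInf ((fun T : Lb E => T x) '' D)
  have hglb : ∀ x, 0 ≤ x → IsGLB ((fun T : Lb E => T x) '' D) (g x) := fun x hx =>
    isGLB_csInf (hne.image _) ⟨L x, by rintro _ ⟨T, hT, rfl⟩; exact hL hT x hx⟩
  have hle : ∀ T ∈ D, ∀ x, 0 ≤ x → g x ≤ T x := fun T hT x hx => (hglb x hx).1 ⟨T, hT, rfl⟩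
  have hadd : ∀ x y : E, 0 ≤ x → 0 ≤ y → g (x + y) = g x + g y := by
    intro x y hx hy
    apply le_antisymm
    · have h1 : ∀ S ∈ D, g (x + y) - S x ≤ g y := by
        intro S hS
        refine (hglb y hy).2 ?_
        rintro _ ⟨T, hT, rfl⟩
        obtain ⟨R, hR, hRS, hRT⟩ := hdir S hS T hT
        rw [sub_le_iff_le_add']
        refine (hle R hR _ (add_nonneg hx hy)).trans ?_
        rw [map_add]
        exact add_le_add (hRS x hx) (hRT y hy)
      rw [← sub_le_iff_le_add]
      refine (hglb x hx).2 ?_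
      rintro _ ⟨S, hS, rfl⟩
      exact sub_le_comm.1 (h1 S hS)
    · refine (hglb _ (add_nonneg hx hy)).2 ?_
      rintro _ ⟨T, hT, rfl⟩
      simp only [map_add]
      exact add_le_add (hle T hT x hx) (hle T hT y hy)
  have hsmul' : ∀ (r : ℝ) (x : E), 0 ≤ r → 0 ≤ x → r • g x ≤ g (r • x) := by
    intro r x hr hx
    refine (hglb _ (smul_nonneg hr hx)).2 ?_
    rintro _ ⟨T, hT, rfl⟩
    simp only [map_smul]
    exact smul_le_smul_of_nonneg_left (hle T hT x hx) hr
  have h00 : g 0 = 0 := by simpa using hadd 0 0 le_rfl le_rfl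
  have hsmul : ∀ (r : ℝ) (x : E), 0 ≤ r → 0 ≤ x → g (r • x) = r • g x := by
    intro r x hr hx
    rcases hr.eq_or_lt with rfl | hr
    · rw [zero_smul, zero_smul, h00]
    · refine le_antisymm ?_ (hsmul' r x hr.le hx)
      have h := hsmul' r⁻¹ (r • x) (inv_nonneg.2 hr.le) (smul_nonneg hr.le hx)
      rw [smul_smul, inv_mul_cancel₀ hr.ne', one_smul] at h
      have := smul_le_smul_of_nonneg_left h hr.le
      rwa [smul_smul, mul_inv_cancel₀ hr.ne', one_smul] at this
  obtain ⟨G, hG⟩ := exists_end_of_cone g hadd hsmul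
  have hGL : Monotone (G - L.toEnd) := by
    intro x y hxy
    rw [← sub_nonneg, ← map_sub, LinearMap.sub_apply, hG _ (sub_nonneg.2 hxy), sub_nonneg]
    refine (hglb _ (sub_nonneg.2 hxy)).2 ?_
    rintro _ ⟨T, hT, rfl⟩
    exact hL hT _ (sub_nonneg.2 hxy)
  have hGb : G ∈ orderBoundedSubalgebra E := by
    have := (orderBoundedSubalgebra E).add_mem (isOrderBounded_of_monotone hGL) L.2
    rwa [show G - L.toEnd + L.1 = G from sub_add_cancel G _] at this
  refine ⟨⟨G, hGb⟩, ⟨fun T hT x hx => ?_, fun S hS x hx => ?_⟩, fun x hx => ?_⟩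
  · exact (hG x hx).trans_le (hle T hT x hx)
  · refine le_of_le_of_eq ((hglb x hx).2 ?_) (hG x hx).symm
    rintro _ ⟨T, hT, rfl⟩
    exact hS hT x hx
  · exact (congrArg _ (hG x hx)).mpr (hglb x hx)

/-- `L_b(E)` is Dedekind complete. -/
lemma Lb.exists_isLUB {M : Set (Lb E)} (hne : M.Nonempty) (hb : BddAbove M) :
    ∃ S : Lb E, IsLUB M S := by
  obtain ⟨S, hS, -⟩ := exists_isGLB_of_directed (D := upperBounds M) hb
    (fun S hS T hT => ⟨S ⊓ T, fun R hR => le_inf (hS hR) (hT hR), inf_le_left, inf_le_right⟩)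
    (hne.bddBelow_upperBounds)
  exact ⟨S, isGLB_upperBounds.1 hS⟩

/-- Pointwise bounds pass to suprema of directed sets of operators. -/
lemma Lb.isLUB_apply_le_of_directed {M : Set (Lb E)} {S : Lb E} (hne : M.Nonempty)
    (hdir : ∀ S ∈ M, ∀ T ∈ M, ∃ R ∈ M, S ≤ R ∧ T ≤ R) (hS : IsLUB M S) {x d : E} (hx : 0 ≤ x)
    (h : ∀ T ∈ M, T x ≤ d) : S x ≤ d := by
  obtain ⟨G, hG, hGx⟩ := exists_isGLB_of_directed (D := Neg.neg '' M) (hne.image _)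
    (by
      rintro _ ⟨T, hT, rfl⟩ _ ⟨T', hT', rfl⟩
      obtain ⟨R, hR, h1, h2⟩ := hdir T hT T' hT'
      exact ⟨-R, ⟨R, hR, rfl⟩, neg_le_neg h1, neg_le_neg h2⟩)
    ⟨-S, by rintro _ ⟨T, hT, rfl⟩; exact neg_le_neg (hS.1 hT)⟩
  have h1 : S ≤ -G := hS.2 fun T hT => le_neg_of_le_neg (hG.1 ⟨T, hT, rfl⟩)
  refine (h1 x hx).trans ?_
  rw [Lb.neg_apply, neg_le]
  refine (hGx x hx).2 ?_
  rintro _ ⟨_, ⟨T, hT, rfl⟩, rfl⟩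
  exact neg_le_neg (h T hT)

/-- Pointwise bounds pass to suprema of arbitrary sets of orthomorphisms, because finite suprema
of orthomorphisms are pointwise. -/
lemma Orth.isLUB_apply_le {M : Set (Lb E)} {S : Lb E} (hM : M ⊆ Orth E) (hne : M.Nonempty)
    (hS : IsLUB M S) {x d : E} (hx : 0 ≤ x) (h : ∀ T ∈ M, T x ≤ d) : S x ≤ d := by
  have hsub : supClosure M ⊆ {T | T ∈ Orth E ∧ T x ≤ d} :=
    supClosure_min (fun T hT => ⟨hM hT, h T hT⟩) fun T hT R hR =>
      ⟨Orth.sup_mem hT.1 hR.1, by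
        rw [Orth.sup_apply hT.1 hR.1 hx]
        exact sup_le hT.2 hR.2⟩
  refine Lb.isLUB_apply_le_of_directed (M := supClosure M) (hne.mono subset_supClosure) ?_
    (isLUB_supClosure.2 hS) hx fun T hT => (hsub hT).2
  exact fun T hT R hR => ⟨T ⊔ R, supClosed_supClosure hT hR, le_sup_left, le_sup_right⟩

end Operators

/-! ### Limits of nets of orthomorphisms -/

section Limits

variable {E : Type u} [ConditionallyCompleteLattice E] [AddCommGroup E] [IsOrderedAddMonoid E]
  [Module ℝ E] [PosSMulMono ℝ E]
variable {A : Type v} [Preorder A] [IsDirectedOrder A] [Nonempty A]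

lemma suoConverges_iff {T : A → Lb E} {L : Lb E} :
    SUOConverges T L ↔ ∀ x : E, 0 ≤ x → LocallyNull (fun a => |T a x - L x|) := by
  constructor
  · exact fun h x _ => uoConverges_iff_locallyNull.1 (h x)
  · intro h x
    refine uoConverges_iff_locallyNull.2
      (((h _ (posPart_nonneg x)).add (h _ (negPart_nonneg x))).mono fun a => ?_)
    rw [(T a).apply_eq_posPart_sub, L.apply_eq_posPart_sub, sub_sub_sub_comm]
    exact (abs_sub_le_abs_add _ _)

lemma UOConverges.isGLB_apply {T : A → Lb E} {L Y : Lb E} (h : UOConverges T L) (hY : 0 ≤ Y)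
    {x : E} (hx : 0 ≤ x) :
    IsGLB ((fun R : Lb E => R x) '' {R | ∃ a₀ : A, ∀ a, a₀ ≤ a → |T a - L| ⊓ Y ≤ R}) 0 := by
  have hD := uoConverges_iff_isGLB.1 h Y hY
  obtain ⟨a⟩ := ‹Nonempty A›
  obtain ⟨G, hG, hGx⟩ := exists_isGLB_of_directed
    (D := {R | ∃ a₀ : A, ∀ a, a₀ ≤ a → |T a - L| ⊓ Y ≤ R}) ⟨Y, a, fun _ _ => inf_le_right⟩
    (by
      rintro R ⟨i, hi⟩ S ⟨j, hj⟩
      obtain ⟨k, hik, hjk⟩ := exists_ge_ge i j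
      exact ⟨R ⊓ S, ⟨k, fun a ha => le_inf (hi a (hik.trans ha)) (hj a (hjk.trans ha))⟩,
        inf_le_left, inf_le_right⟩) ⟨0, hD.1⟩
  have := hGx x hx
  rwa [hG.unique hD] at this

/-- The orthomorphisms are closed under unbounded order limits. -/
lemma UOConverges.mem_Orth {T : A → Lb E} {L : Lb E} (h : UOConverges T L)
    (hT : ∀ a, T a ∈ Orth E) : L ∈ Orth E := by
  refine mem_Orth_of_abs (mem_Orth_of_forall_nonneg fun x w hx hxw => ?_)
  have hLx : 0 ≤ |L| x := Lb.apply_nonneg (abs_nonneg L) hx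
  rw [mem_disjCompl, abs_of_nonneg hLx]
  refine le_antisymm ((h.isGLB_apply (abs_nonneg L) hx).2 ?_) (le_inf hLx (abs_nonneg w))
  rintro _ ⟨R, ⟨a, ha⟩, rfl⟩
  have hR : |T a - L| ⊓ |L| ≤ R := ha a le_rfl
  have h1 : |L| ≤ |T a| + R := by
    have h2 : |L| ≤ (|T a| + |T a - L|) ⊓ |L| := by
      refine le_inf ?_ le_rfl
      have e : L = T a - (T a - L) := by abel
      conv_lhs => rw [e]
      exact abs_sub_le_abs_add _ _
    exact h2.trans ((add_inf_le_inf_add_inf (abs_nonneg _) (abs_nonneg _) (abs_nonneg _)).trans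
      (add_le_add inf_le_left hR))
  have hR0 : 0 ≤ R := (le_inf (abs_nonneg _) (abs_nonneg _)).trans hR
  have hTx := Lb.apply_nonneg (abs_nonneg (T a)) hx
  have hd : |T a| x ∈ disjCompl w := mem_Orth_iff.1 (Orth.abs_mem (hT a)) x w hxw
  rw [mem_disjCompl, abs_of_nonneg hTx] at hd
  calc |L| x ⊓ |w| ≤ (|T a| x + R x) ⊓ |w| := inf_le_inf_right _ (h1 x hx)
    _ ≤ |T a| x ⊓ |w| + R x ⊓ |w| := add_inf_le_inf_add_inf hTx (hR0 x hx) (abs_nonneg w)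
    _ ≤ R x := by rw [hd, zero_add]; exact inf_le_left

/-- The orthomorphisms are closed under pointwise unbounded order limits. -/
lemma SUOConverges.mem_Orth {T : A → Lb E} {L : Lb E} (h : SUOConverges T L)
    (hT : ∀ a, T a ∈ Orth E) : L ∈ Orth E := by
  refine mem_Orth_iff.2 fun x w hx => ?_
  by_contra hne
  have hz : 0 < |L x| ⊓ |w| := (le_inf (abs_nonneg _) (abs_nonneg _)).lt_of_ne (Ne.symm hne)
  set z := |L x| ⊓ |w|
  obtain ⟨-, hkz, e⟩ := inv_two_smul_spec hz
  obtain ⟨v, hv, hvk, a, ha⟩ := uoConverges_iff_locallyNull.1 (h x) _ (inv_two_smul_spec hz).1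
  set k := (2⁻¹ : ℝ) • z
  have h1 : |T a x| ∈ disjCompl v := by
    have := mem_Orth_iff.1 (hT a) x w hx
    rw [mem_disjCompl_comm, ← abs_mem_disjCompl, ← mem_disjCompl_comm, ← abs_mem_disjCompl] at this
    exact mem_disjCompl_anti hv.le (hvk.trans (hkz.trans inf_le_right)) this
  have h2 : k ≤ (|T a x - L x| - k)⁺ + |T a x| := by
    have h3 : k + k ≤ |T a x - L x| + |T a x| := by
      rw [e]
      refine (inf_le_left : z ≤ |L x|).trans ?_
      have e' : L x = T a x - (T a x - L x) := by abel
      conv_lhs => rw [e']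
      exact (abs_sub_le_abs_add _ _).trans (add_comm _ _).le
    have h4 : k ≤ (|T a x - L x| - k) + |T a x| := by
      rw [← add_sub_right_comm, le_sub_iff_add_le]
      exact h3
    exact h4.trans (add_le_add_left (le_posPart _) _)
  exact hv.ne' (eq_zero_of_mem_disjCompl_self
    (mem_disjCompl_of_le hv.le (hvk.trans h2) (add_mem (ha a le_rfl) h1)))

lemma Lb.zero_le_one : (0 : Lb E) ≤ 1 := fun _ hx => hx

/-- Unbounded order convergence implies pointwise convergence: truncating by a multiple of the
identity controls the net at `x` on the part of `E` below `x`, and off `x` it vanishes. -/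
lemma UOConverges.suoConverges {T : A → Lb E} {L : Lb E} (h : UOConverges T L)
    (hT : ∀ a, T a ∈ Orth E) : SUOConverges T L := by
  have hd : ∀ a, T a - L ∈ Orth E := fun a => sub_mem (hT a) (h.mem_Orth hT)
  refine suoConverges_iff.2 fun x hx z hz => ?_
  have h0 : 0 ≤ z ⊓ x := le_inf hz.le hx
  by_cases hzx : z ⊓ x = 0
  · obtain ⟨a₀⟩ := ‹Nonempty A›
    refine ⟨z, hz, le_rfl, a₀, fun a _ => ?_⟩
    have h1 : x ∈ disjCompl z := by rwa [mem_disjCompl_iff hx hz.le, inf_comm]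
    exact mem_disjCompl_of_le (posPart_nonneg _) (sup_le (sub_le_self _ hz.le) (abs_nonneg _))
      (abs_mem_disjCompl.2 (mem_Orth_iff.1 (hd a) x z h1))
  · have h2 : (0 : Lb E) ≤ 1 + 1 := add_nonneg Lb.zero_le_one Lb.zero_le_one
    obtain ⟨w, hw, hwz, a₀, ha⟩ := exists_posPart_sub_mem_disjCompl
      (u := fun a => |T a x - L x|) (h0.lt_of_ne (Ne.symm hzx)) inf_le_right
      (h.isGLB_apply h2 hx) (by
        rintro _ ⟨R, ⟨a₀, ha⟩, rfl⟩
        refine ⟨a₀, fun a h' => ?_⟩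
        have := ha a h' x hx
        rwa [Orth.inf_apply (Orth.abs_mem (hd a)) (add_mem (one_mem _) (one_mem _)) hx,
          Orth.abs_apply (hd a) hx] at this)
    exact ⟨w, hw, hwz.trans inf_le_left, a₀, fun a h' => mem_disjCompl_of_le (posPart_nonneg _)
      (posPart_mono (sub_le_sub_left inf_le_left _)) (ha a h')⟩

/-- Pointwise convergence implies unbounded order convergence: the suprema of the tails of
`|T a - L| ⊓ Y` are computed pointwise, although `Y` need not be an orthomorphism. -/
lemma SUOConverges.uoConverges {T : A → Lb E} {L : Lb E} (h : SUOConverges T L)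
    (hT : ∀ a, T a ∈ Orth E) : UOConverges T L := by
  have hd : ∀ a, T a - L ∈ Orth E := fun a => sub_mem (hT a) (h.mem_Orth hT)
  refine uoConverges_iff_isGLB.2 fun Y hY => ?_
  have h0 : ∀ a, 0 ≤ |T a - L| ⊓ Y := fun a => le_inf (abs_nonneg _) hY
  refine ⟨fun R ⟨a₀, h⟩ => (h0 a₀).trans (h a₀ le_rfl), fun Z hZ x hx => ?_⟩
  refine (uoConverges_iff_isGLB.1 (h x) (Y x) (hY x hx)).2 ?_
  rintro d ⟨a₀, ha⟩
  have hne : ((fun a => |T a - L| ⊓ Y) '' Ici a₀).Nonempty := ⟨_, a₀, self_mem_Ici, rfl⟩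
  obtain ⟨S, hS⟩ := Lb.exists_isLUB hne ⟨Y, by rintro _ ⟨a, -, rfl⟩; exact inf_le_right⟩
  have hZS : Z ≤ S := hZ ⟨a₀, fun a h' => hS.1 ⟨a, h', rfl⟩⟩
  refine (hZS x hx).trans (Orth.isLUB_apply_le ?_ hne hS hx ?_)
  · rintro _ ⟨a, -, rfl⟩
    exact Orth.mem_of_nonneg_of_le (Orth.abs_mem (hd a)) (h0 a) inf_le_left
  · rintro _ ⟨a, h', rfl⟩
    refine le_trans (le_inf ?_ ?_) (ha a h')
    · exact ((inf_le_left : |T a - L| ⊓ Y ≤ _) x hx).trans (Orth.abs_apply (hd a) hx).le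
    · exact (inf_le_right : |T a - L| ⊓ Y ≤ _) x hx

lemma uoConverges_iff_suoConverges {T : A → Lb E} {L : Lb E} (hT : ∀ a, T a ∈ Orth E) :
    UOConverges T L ↔ SUOConverges T L :=
  ⟨fun h => h.suoConverges hT, fun h => h.uoConverges hT⟩

lemma Mode.converges_iff_suoConverges (m : Mode) {T : A → Lb E} {L : Lb E}
    (hT : ∀ a, T a ∈ Orth E) : m.Converges T L ↔ SUOConverges T L := by
  cases m
  · exact uoConverges_iff_suoConverges hT
  · exact Iff.rfl

/-! ### Products, sums and suprema of convergent nets -/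

/-- A positive orthomorphism that vanishes at `z` locally on `w` vanishes there at every vector,
provided that `w` lies below a multiple of `z`. -/
lemma Orth.apply_mem_disjCompl {R : Lb E} (hR : R ∈ Orth E) (hR0 : 0 ≤ R) {z w u : E} {c : ℝ}
    (hw : 0 ≤ w) (hwz : w ≤ c • z) (hz : R z ∈ disjCompl w) (hu : 0 ≤ u) :
    R u ∈ disjCompl w := by
  have hRu := hR0 u hu
  change 0 ≤ R u at hRu
  by_contra hne
  rw [mem_disjCompl_iff hRu hw] at hne
  have hv : 0 < R u ⊓ w := (le_inf hRu hw).lt_of_ne (Ne.symm hne)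
  set v := R u ⊓ w
  obtain ⟨n, hn⟩ : ∃ n : ℕ, ¬ (n : ℝ) • v ≤ u := by
    by_contra! hc
    exact hv.not_ge (nonpos_of_forall_natCast_smul_le hc)
  have hnv : 0 ≤ (n : ℝ) • v := smul_nonneg (Nat.cast_nonneg n) hv.le
  -- on the support of `p` the vector `u` lies below `n • v`
  set p := ((n : ℝ) • v - u)⁺
  have hp0 : 0 < p := (posPart_nonneg _).lt_of_ne fun h0 =>
    hn (sub_nonpos.1 (posPart_eq_zero.1 h0.symm))
  have hpv : p ≤ (n : ℝ) • v := sup_le (sub_le_self _ hu) hnv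
  have h1 : R (u - (n : ℝ) • v)⁺ ∈ disjCompl p := by
    refine mem_Orth_iff.1 hR _ _ ?_
    rw [← neg_sub, posPart_neg]
    exact mem_disjCompl_comm.1 (posPart_mem_disjCompl_negPart _)
  have h2 : R ((n : ℝ) • v) ∈ disjCompl p := by
    have h3 : R w ∈ disjCompl w := by
      refine mem_disjCompl_of_le (hR0 w hw) (Lb.apply_mono hR0 hwz) ?_
      rw [map_smul]
      exact Submodule.smul_mem _ _ hz
    have h4 : R v ∈ disjCompl w :=
      mem_disjCompl_of_le (hR0 v hv.le) (Lb.apply_mono hR0 inf_le_right) h3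
    rw [map_smul]
    refine Submodule.smul_mem _ _ (mem_disjCompl_anti hp0.le
      (hpv.trans (smul_le_smul_of_nonneg_left inf_le_right (Nat.cast_nonneg n))) ?_)
    exact mem_disjCompl_comm.1 (Submodule.smul_mem _ _ (mem_disjCompl_comm.1 h4))
  have h5 : R u ∈ disjCompl p := by
    refine mem_disjCompl_of_le hRu ?_ (add_mem h2 h1)
    rw [← map_add]
    refine Lb.apply_mono hR0 ?_
    rw [← sub_le_iff_le_add']
    exact le_posPart _
  have h6 : v ∈ disjCompl p := mem_disjCompl_of_le hv.le inf_le_left h5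
  exact hp0.ne' (eq_zero_of_mem_disjCompl_self
    (mem_disjCompl_of_le hp0.le hpv (Submodule.smul_mem _ _ h6)))

/-- A pointwise convergent net of orthomorphisms is locally eventually bounded by a multiple `c`
of the identity: `(|S a| - c)⁺` vanishes on `w`. -/
lemma SUOConverges.exists_eventually_bounded {S : A → Lb E} {L : Lb E} (h : SUOConverges S L)
    (hS : ∀ a, S a ∈ Orth E) {z : E} (hz : 0 < z) :
    ∃ (w : E) (c : ℝ), 0 < w ∧ w ≤ z ∧ 0 < c ∧ ∃ a₀, ∀ a, a₀ ≤ a → ∀ u, 0 ≤ u →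
      ((|S a| - c • 1) ⊔ 0) u ∈ disjCompl w := by
  obtain ⟨n, hn⟩ : ∃ n : ℕ, ¬ (n : ℝ) • z ≤ |L z| := by
    by_contra! hc
    exact hz.not_ge (nonpos_of_forall_natCast_smul_le hc)
  have hnz : 0 ≤ (n : ℝ) • z := smul_nonneg (Nat.cast_nonneg n) hz.le
  have hw₁ : 0 < ((n : ℝ) • z - |L z|)⁺ := (posPart_nonneg _).lt_of_ne fun h0 =>
    hn (sub_nonpos.1 (posPart_eq_zero.1 h0.symm))
  obtain ⟨w, hw, hww₁, a₀, ha⟩ := uoConverges_iff_locallyNull.1 (h z) _ hw₁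
  set w₁ := ((n : ℝ) • z - |L z|)⁺
  have hw₁z : w₁ ≤ (n : ℝ) • z := sup_le (sub_le_self _ (abs_nonneg _)) hnz
  -- `|L| ≤ n` on `w`, and `|S a - L| ≤ n` eventually there
  set c : ℝ := n + n + 1 with hc
  have hc0 : 0 < c := by positivity
  have hc1 : c⁻¹ ≤ 1 := inv_le_one_of_one_le₀ (by rw [hc]; linarith [n.cast_nonneg (α := ℝ)])
  have hcw : c⁻¹ • w ≤ w := (smul_le_smul_of_nonneg_right hc1 hw.le).trans (one_smul _ w).le
  have hcw0 : 0 < c⁻¹ • w := smul_pos_of_pos (inv_pos.2 hc0) hw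
  refine ⟨c⁻¹ • w, c, hcw0, ?_, hc0, a₀, fun a h' u hu => ?_⟩
  · have h1 := smul_le_smul_of_nonneg_left (hww₁.trans hw₁z) (inv_nonneg.2 hc0.le)
    rw [smul_smul] at h1
    refine h1.trans ((smul_le_smul_of_nonneg_right ?_ hz.le).trans (one_smul _ z).le)
    rw [inv_mul_le_one₀ hc0, hc]
    linarith [n.cast_nonneg (α := ℝ)]
  · have hK : |S a| - c • 1 ∈ Orth E :=
      sub_mem (Orth.abs_mem (hS a)) (Subalgebra.smul_mem _ (one_mem _) c)
    refine mem_disjCompl_anti hcw0.le hcw (Orth.apply_mem_disjCompl (z := z) (c := n)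
      (Orth.sup_mem hK (zero_mem _)) le_sup_right hw.le (hww₁.trans hw₁z) ?_ hu)
    rw [Orth.sup_apply hK (zero_mem _) hz.le, Lb.sub_apply, Orth.abs_apply (hS a) hz.le,
      Lb.smul_apply, Lb.one_apply, Lb.zero_apply, ← posPart_def]
    have h1 : (|L z| - (n : ℝ) • z)⁺ ∈ disjCompl w := by
      refine mem_disjCompl_anti hw.le hww₁ ?_
      rw [← neg_sub, posPart_neg]
      exact mem_disjCompl_comm.1 (posPart_mem_disjCompl_negPart _)
    refine mem_disjCompl_of_le (posPart_nonneg _) ?_ (add_mem h1 (ha a h'))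
    refine (posPart_mono ?_).trans (posPart_add_le _ _)
    have h2 : |S a z| ≤ |L z| + |S a z - L z| := by
      have e : S a z = L z + (S a z - L z) := by abel
      conv_lhs => rw [e]
      exact abs_add_le _ _
    have h3 : (n : ℝ) • z + w₁ ≤ c • z := by
      rw [hc, add_smul, add_smul, one_smul]
      exact (add_le_add_right hw₁z _).trans (le_add_of_nonneg_right hz.le)
    calc |S a z| - c • z ≤ (|L z| + |S a z - L z|) - ((n : ℝ) • z + w₁) := sub_le_sub h2 h3
      _ = _ := by abel

/-- Local boundedness of the net `S` makes `|S a|` carry locally null nets to locally null nets,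
uniformly in `a`. -/
lemma SUOConverges.locallyNull_abs_apply {B : Type*} [Preorder B] [IsDirectedOrder B]
    [Nonempty B] {S : A → Lb E} {L : Lb E} (h : SUOConverges S L) (hS : ∀ a, S a ∈ Orth E)
    {v : B → E} (hv0 : ∀ b, 0 ≤ v b) (hv : LocallyNull v) :
    LocallyNull (fun p : A × B => |S p.1| (v p.2)) := by
  intro z hz
  obtain ⟨w, c, hw, hwz, hc, a₀, ha⟩ := h.exists_eventually_bounded hS hz
  obtain ⟨q, hq, hqw, hqc⟩ : ∃ q, 0 < q ∧ q ≤ w ∧ c • q ≤ w := by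
    have hpos : 0 < (max 1 c)⁻¹ := by positivity
    have hle : ∀ r ≤ max 1 c, r • (max 1 c)⁻¹ • w ≤ w := fun r hr => by
      rw [smul_smul]
      refine (smul_le_smul_of_nonneg_right ?_ hw.le).trans (one_smul ℝ w).le
      rw [← div_eq_mul_inv]
      exact div_le_one_of_le₀ hr (by positivity)
    exact ⟨_, smul_pos_of_pos hpos hw, by simpa using hle 1 (le_max_left _ _),
      hle c (le_max_right _ _)⟩
  obtain ⟨k, hk, hkq, b₀, hb⟩ := hv q hq
  refine ⟨k, hk, hkq.trans (hqw.trans hwz), (a₀, b₀), fun p hp => ?_⟩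
  have h1 := mem_disjCompl_anti hk.le (hkq.trans hqw) (ha p.1 hp.1 (v p.2) (hv0 p.2))
  have h2 := Submodule.smul_mem _ c (hb p.2 hp.2)
  set R := (|S p.1| - c • 1) ⊔ 0
  have hR : |S p.1| (v p.2) ≤ c • v p.2 + R (v p.2) := by
    have h3 : |S p.1| - c • 1 ≤ R := le_sup_left
    exact sub_le_iff_le_add'.1 (h3 _ (hv0 p.2))
  have hR0 : 0 ≤ R (v p.2) := (le_sup_right : 0 ≤ R) _ (hv0 p.2)
  refine mem_disjCompl_of_le (posPart_nonneg _) ?_ (add_mem h2 h1)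
  refine sup_le ?_ (add_nonneg (smul_nonneg hc.le (posPart_nonneg _)) hR0)
  calc |S p.1| (v p.2) - z ≤ c • v p.2 + R (v p.2) - c • q := sub_le_sub hR (hqc.trans hwz)
    _ = c • (v p.2 - q) + R (v p.2) := by rw [smul_sub]; abel
    _ ≤ _ := add_le_add_left (smul_le_smul_of_nonneg_left (le_posPart _) hc.le) _

instance isDirectedOrder_prod {B : Type*} [Preorder B] [IsDirectedOrder B] :
    IsDirectedOrder (A × B) where
  directed p q := by
    obtain ⟨a, h1, h2⟩ := exists_ge_ge p.1 q.1
    obtain ⟨b, h3, h4⟩ := exists_ge_ge p.2 q.2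
    exact ⟨(a, b), ⟨h1, h3⟩, ⟨h2, h4⟩⟩

/-- Joint continuity of multiplication, from the decomposition
`S a * T b - S * T = S a * (T b - T) + (S a - S) * T`. -/
lemma SUOConverges.mul {B : Type*} [Preorder B] [IsDirectedOrder B] [Nonempty B]
    {S : A → Lb E} {T : B → Lb E} {L K : Lb E} (hS : SUOConverges S L) (hT : SUOConverges T K)
    (hSO : ∀ a, S a ∈ Orth E) : SUOConverges (fun p : A × B => S p.1 * T p.2) (L * K) := by
  refine fun x => uoConverges_iff_locallyNull.2 ?_
  have h1 := hS.locallyNull_abs_apply hSO (fun b => abs_nonneg _)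
    (uoConverges_iff_locallyNull.1 (hT x))
  have h2 := (uoConverges_iff_locallyNull.1 (hS (K x))).comp_fst (B := B)
  refine (h1.add h2).mono fun p => ?_
  have e : (S p.1 * T p.2) x - (L * K) x
      = S p.1 (T p.2 x - K x) + (S p.1 (K x) - L (K x)) := by
    rw [Lb.mul_apply, Lb.mul_apply, map_sub]
    abel
  rw [e]
  exact (abs_add_le _ _).trans (add_le_add_left (Lb.abs_apply_le _ _) _)

lemma SUOConverges.add {B : Type*} [Preorder B] [IsDirectedOrder B] [Nonempty B]
    {S : A → Lb E} {T : B → Lb E} {L K : Lb E} (hS : SUOConverges S L) (hT : SUOConverges T K) :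
    SUOConverges (fun p : A × B => S p.1 + T p.2) (L + K) := by
  refine fun x => uoConverges_iff_locallyNull.2 ?_
  refine (((uoConverges_iff_locallyNull.1 (hS x)).comp_fst (B := B)).add
    ((uoConverges_iff_locallyNull.1 (hT x)).comp_snd (B := A))).mono fun p => ?_
  rw [Lb.add_apply, Lb.add_apply, add_sub_add_comm]
  exact abs_add_le _ _

lemma SUOConverges.sup {B : Type*} [Preorder B] [IsDirectedOrder B] [Nonempty B]
    {S : A → Lb E} {T : B → Lb E} {L K : Lb E} (hS : SUOConverges S L) (hT : SUOConverges T K)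
    (hSO : ∀ a, S a ∈ Orth E) (hTO : ∀ b, T b ∈ Orth E) :
    SUOConverges (fun p : A × B => S p.1 ⊔ T p.2) (L ⊔ K) := by
  refine suoConverges_iff.2 fun x hx => ?_
  refine (((uoConverges_iff_locallyNull.1 (hS x)).comp_fst (B := B)).add
    ((uoConverges_iff_locallyNull.1 (hT x)).comp_snd (B := A))).mono fun p => ?_
  rw [Orth.sup_apply (hSO _) (hTO _) hx, Orth.sup_apply (hS.mem_Orth hSO) (hT.mem_Orth hTO) hx]
  exact abs_sup_sub_sup_le _ _ _ _

lemma suoConverges_const (L : Lb E) : SUOConverges (fun _ : A => L) L := by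
  intro x
  refine uoConverges_iff_locallyNull.2 fun z hz => ?_
  obtain ⟨a⟩ := ‹Nonempty A›
  refine ⟨z, hz, le_rfl, a, fun _ _ => ?_⟩
  simp only [sub_self, abs_zero]
  rw [posPart_eq_zero.2 (sub_nonpos.2 hz.le)]
  exact zero_mem _

/-! ### Adherences of subalgebras -/

lemma uoAdherence_eq_suoAdherence {M : Set (Lb E)} (hM : M ⊆ Orth E) :
    uoAdherence M = suoAdherence M := by
  ext L
  constructor
  · rintro ⟨A, _, _, _, T, hT, h⟩
    exact ⟨A, _, ‹_›, ‹_›, T, hT, h.suoConverges fun a => hM (hT a)⟩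
  · rintro ⟨A, _, _, _, T, hT, h⟩
    exact ⟨A, _, ‹_›, ‹_›, T, hT, h.uoConverges fun a => hM (hT a)⟩

lemma suoAdherence_subset_Orth {M : Set (Lb E)} (hM : M ⊆ Orth E) :
    suoAdherence M ⊆ Orth E := by
  rintro L ⟨A, _, _, _, T, hT, h⟩
  exact h.mem_Orth fun a => hM (hT a)

/-- The adherence of a subalgebra of the orthomorphisms, as a subalgebra. -/
def adherenceSubalgebra (M : NonUnitalSubalgebra ℝ (Lb E)) (hM : (M : Set (Lb E)) ⊆ Orth E) :
    NonUnitalSubalgebra ℝ (Lb E) where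
  carrier := suoAdherence (M : Set (Lb E))
  zero_mem' := ⟨PUnit, inferInstance, inferInstance, inferInstance, fun _ => 0,
    fun _ => zero_mem M, suoConverges_const 0⟩
  add_mem' := by
    rintro L K ⟨A, _, _, _, S, hS, hSL⟩ ⟨B, _, _, _, T, hT, hTK⟩
    exact ⟨A × B, inferInstance, inferInstance, inferInstance, _,
      fun p => add_mem (hS p.1) (hT p.2), hSL.add hTK⟩
  mul_mem' := by
    rintro L K ⟨A, _, _, _, S, hS, hSL⟩ ⟨B, _, _, _, T, hT, hTK⟩
    exact ⟨A × B, inferInstance, inferInstance, inferInstance, _,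
      fun p => mul_mem (hS p.1) (hT p.2), hSL.mul hTK fun a => hM (hS a)⟩
  smul_mem' := by
    -- scalar multiplication is multiplication by a constant net of multiples of the identity
    rintro r L ⟨A, _, _, _, T, hT, h⟩
    refine ⟨PUnit.{u + 1} × A, inferInstance, inferInstance, inferInstance,
      fun p : PUnit.{u + 1} × A => (r • 1) * T p.2,
      fun p => ?_, ?_⟩
    · simp only [smul_one_mul]
      exact SMulMemClass.smul_mem r (hT p.2)
    · have h' := (suoConverges_const (A := PUnit.{u + 1}) (r • (1 : Lb E))).mul h
        fun _ => Subalgebra.smul_mem _ (one_mem _) r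
      rwa [smul_one_mul] at h'

lemma isSublattice_adherenceSubalgebra {M : NonUnitalSubalgebra ℝ (Lb E)}
    (hM : (M : Set (Lb E)) ⊆ Orth E) (h : IsSublattice (M : Set (Lb E))) :
    IsSublattice (adherenceSubalgebra M hM : Set (Lb E)) := by
  have hsup : ∀ L ∈ adherenceSubalgebra M hM, ∀ K ∈ adherenceSubalgebra M hM,
      L ⊔ K ∈ adherenceSubalgebra M hM := by
    rintro L ⟨A, _, _, _, S, hS, hSL⟩ K ⟨B, _, _, _, T, hT, hTK⟩
    exact ⟨A × B, inferInstance, inferInstance, inferInstance, _,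
      fun p => h.supClosed (hS p.1) (hT p.2),
      hSL.sup hTK (fun a => hM (hS a)) fun b => hM (hT b)⟩
  refine ⟨fun L hL K hK => hsup L hL K hK, fun L hL K hK => ?_⟩
  have e : L ⊓ K = L + K - (L ⊔ K) := by rw [← inf_add_sup L K, add_sub_cancel_right]
  rw [e]
  exact sub_mem (add_mem hL hK) (hsup L hL K hK)

end Limits

end OrthoUO

theorem mainTheorem8 {E : Type*} [ConditionallyCompleteLattice E] [AddCommGroup E]
    [IsOrderedAddMonoid E] [Module ℝ E] [PosSMulMono ℝ E] :
    -- simultaneous continuity of multiplication, in all eight variants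
    (∀ (m₁ m₂ m₃ : OrthoUO.Mode)
      {A : Type*} [Preorder A] [IsDirectedOrder A] [Nonempty A]
      {B : Type*} [Preorder B] [IsDirectedOrder B] [Nonempty B]
      (Sₙ : A → OrthoUO.Lb E) (Tₙ : B → OrthoUO.Lb E) (S T : OrthoUO.Lb E),
      (∀ a, Sₙ a ∈ OrthoUO.Orth E) → (∀ b, Tₙ b ∈ OrthoUO.Orth E) →
      m₁.Converges Sₙ S → m₂.Converges Tₙ T →
      S ∈ OrthoUO.Orth E ∧ T ∈ OrthoUO.Orth E ∧
        m₃.Converges (fun p : A × B => Sₙ p.1 * Tₙ p.2) (S * T)) ∧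
    -- adherences of (not necessarily unital) subalgebras of `Orth E`
    (∀ M : NonUnitalSubalgebra ℝ (OrthoUO.Lb E), (M : Set (OrthoUO.Lb E)) ⊆ OrthoUO.Orth E →
      OrthoUO.uoAdherence (M : Set (OrthoUO.Lb E)) = OrthoUO.suoAdherence (M : Set (OrthoUO.Lb E)) ∧
      ∃ N : NonUnitalSubalgebra ℝ (OrthoUO.Lb E),
        (N : Set (OrthoUO.Lb E)) = OrthoUO.uoAdherence (M : Set (OrthoUO.Lb E)) ∧
        (N : Set (OrthoUO.Lb E)) ⊆ OrthoUO.Orth E ∧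
        (IsSublattice (M : Set (OrthoUO.Lb E)) → IsSublattice (N : Set (OrthoUO.Lb E)))) := by
  refine ⟨fun m₁ m₂ m₃ A _ _ _ B _ _ _ Sₙ Tₙ S T hS hT h₁ h₂ => ?_, fun M hM => ?_⟩
  · rw [m₁.converges_iff_suoConverges hS] at h₁
    rw [m₂.converges_iff_suoConverges hT] at h₂
    refine ⟨h₁.mem_Orth hS, h₂.mem_Orth hT, ?_⟩
    rw [m₃.converges_iff_suoConverges fun p : A × B => mul_mem (hS p.1) (hT p.2)]
    exact h₁.mul h₂ hS
  · have e := OrthoUO.uoAdherence_eq_suoAdherence hM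
    exact ⟨e, OrthoUO.adherenceSubalgebra M hM, e.symm, OrthoUO.suoAdherence_subset_Orth hM,
      OrthoUO.isSublattice_adherenceSubalgebra hM⟩
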